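/- Let $q_0,q_1,q_2\in\mathbb{R}^2$ be the vertices of an equilateral triangle of side length $1$, let $F_i(x)=\frac12(x-q_i)+q_i$, and let $K$ be the Sierpinski gasket, i.e. the unique nonempty compact set with $K=F_0(K)\cup F_1(K)\cup F_2(K)$. For a word $w=w_1\cdots w_m$ over $\{0,1,2\}$ put $F_w=F_{w_1}\circ\cdots\circ F_{w_m}$. Let $V_0=\{q_0,q_1,q_2\}$ and $V_m=\bigcup_{|w|=m}F_wV_0$. Let $G_m=(V_m,E_m)$, $m\ge 0$, be the graph in which two distinct points $p,p'\in V_m$ are joined by an edge, $p\sim_m p'$, if $p,p'\in F_wV_0$ for some word $w$ of length $m$. For each $e\in E_m$ fix which of its endpoints is the initial vertex $i(e)$ and which is the terminal vertex $j(e)$. For $f:K\to\mathbb{R}$ set $$\mathcal{E}_m(f)=\left(\tfrac35\right)^{-m}\sum_{p\in V_m}\sum_{p'\sim_m p}(f(p)-f(p'))^2 .$$ A continuous function $f$ on $K$ is called $m$-piecewise harmonic if for every $n\ge m+1$ it minimizes $\mathcal{E}_n$ amongst all functions on $K$ which coincide with $f$ on $V_m$. For $p\in V_m$ let $\psi_{p,m}$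 be the $m$-piecewise harmonic function with $\psi_{p,m}(p')=\delta_{pp'}$ for all $p'\in V_m$; this function exists and is unique. Let $c(p)=\frac12$ if $p\in V_0$ and $c(p)=\frac14$ for all other $p\in\bigcup_{n\ge 0} V_n$, and for $e\in E_m$ set $$\psi_{e,m}=c(i(e))\,\psi_{i(e),m}+c(j(e))\,\psi_{j(e),m}.$$ Let $\mu$ be an atom free nonnegative Radon measure on $K$ with full support. Let $X_m=V_m\cup\bigcup_{e\in E_m}\{e\}\times(0,2^{-m})$ (disjoint union) be the metric graph of $G_m$ with all edges of length $2^{-m}$, endowed with the measure $\mu_m=\sum_{e\in E_m}c_e\lambda_e$, where $\lambda_e$ is the Lebesgue measure on the edge $e$ and $c_e=2^m\int_K\psi_{e,m}\,d\mu$. For a function $f$ on $X_m$ write $f_e(s)=f(e,s)$ and $\overline{f_e}=2^m\int_0^{2^{-m}}f_e(s)\,ds$. Then for every $m\ge 0$ we have $\int_K\psi_{e,m}\,d\mu>0$ for all $e\in E_m$, and $$J_{0,m}f=\sum_{e\in E_m}\overline{f_e}\,\psi_{e,m}$$ defines a bounded linear operator $J_{0,m}:L^2(X_m,\mu_m)\to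 L^2(K,\mu)$ which satisfies $$\|J_{0,m}f\|_{L^2(K,\mu)}\le\|f\|_{L^2(X_m,\mu_m)},\qquad f\in L^2(X_m,\mu_m).$$ Its adjoint $J_{0,m}^\ast:L^2(K,\mu)\to L^2(X_m,\mu_m)$ is given, for $u\in L^2(K,\mu)$ and $\mu_m$-a.e. $t\in X_m$, by $$J_{0,m}^\ast u(t)=\sum_{e\in E_m}\mathbf{1}_e(t)\,\frac{\langle u,\psi_{e,m}\rangle_{L^2(K,\mu)}}{\int_K\psi_{e,m}\,d\mu}.$$ -/

import Mathlib

open MeasureTheory Set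
open scoped NNReal ENNReal

noncomputable section

namespace SG

/-- The Euclidean plane. -/
abbrev Plane : Type := EuclideanSpace ℝ (Fin 2)

/-- The similarity `F_i(x) = (x - q_i) / 2 + q_i`. -/
def F (q : Fin 3 → Plane) (i : Fin 3) (x : Plane) : Plane :=
  (1 / 2 : ℝ) • (x - q i) + q i

theorem lipschitzWith_F (q : Fin 3 → Plane) (i : Fin 3) : LipschitzWith (1 / 2) (F q i) := by
  refine LipschitzWith.of_dist_le_mul fun x y => ?_
  simp only [F, dist_add_right, dist_smul₀, dist_sub_right, NNReal.coe_div, NNReal.coe_one,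
    NNReal.coe_ofNat, Real.norm_eq_abs]
  rw [abs_of_pos (by norm_num)]

/-- The Hutchinson operator `C ↦ F_0(C) ∪ F_1(C) ∪ F_2(C)` on nonempty compact sets. -/
def hutchinson (q : Fin 3 → Plane) (C : TopologicalSpace.NonemptyCompacts Plane) :
    TopologicalSpace.NonemptyCompacts Plane :=
  C.map (F q 0) (lipschitzWith_F q 0).continuous ⊔
    (C.map (F q 1) (lipschitzWith_F q 1).continuous ⊔
      C.map (F q 2) (lipschitzWith_F q 2).continuous)

theorem hausdorffEDist_image_F_le (q : Fin 3 → Plane) (i : Fin 3) (s t : Set Plane) :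
    Metric.hausdorffEDist (F q i '' s) (F q i '' t) ≤
      ((1 / 2 : ℝ≥0) : ℝ≥0∞) * Metric.hausdorffEDist s t := by
  have key : ∀ s t : Set Plane, ∀ x ∈ s, Metric.infEDist (F q i x) (F q i '' t) ≤
      ((1 / 2 : ℝ≥0) : ℝ≥0∞) * Metric.hausdorffEDist s t := by
    intro s t x hx
    have h1 : Metric.infEDist (F q i x) (F q i '' t) ≤
        ((1 / 2 : ℝ≥0) : ℝ≥0∞) * Metric.infEDist x t := by
      simp only [Metric.infEDist]
      rw [ENNReal.mul_iInf_of_ne (by simp) ENNReal.coe_ne_top]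
      refine le_iInf fun y => ?_
      rw [ENNReal.mul_iInf_of_ne (by simp) ENNReal.coe_ne_top]
      refine le_iInf fun hy => ?_
      exact (iInf₂_le (F q i y) (mem_image_of_mem _ hy)).trans (lipschitzWith_F q i x y)
    exact h1.trans (mul_le_mul_right (Metric.infEDist_le_hausdorffEDist_of_mem hx) _)
  refine Metric.hausdorffEDist_le_of_infEDist ?_ ?_
  · rintro _ ⟨x, hx, rfl⟩
    exact key s t x hx
  · rintro _ ⟨x, hx, rfl⟩
    rw [Metric.hausdorffEDist_comm]
    exact key t s x hx

theorem contractingWith_hutchinson (q : Fin 3 → Plane) :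
    ContractingWith (1 / 2) (hutchinson q) := by
  refine ⟨by rw [← NNReal.coe_lt_coe]; norm_num, fun C D => ?_⟩
  change Metric.hausdorffEDist (hutchinson q C : Set Plane) (hutchinson q D) ≤
    _ * Metric.hausdorffEDist (C : Set Plane) D
  simp only [hutchinson, TopologicalSpace.NonemptyCompacts.coe_sup,
    TopologicalSpace.NonemptyCompacts.coe_map]
  refine Metric.hausdorffEDist_union_le.trans (max_le (hausdorffEDist_image_F_le q 0 _ _) ?_)
  exact Metric.hausdorffEDist_union_le.trans
    (max_le (hausdorffEDist_image_F_le q 1 _ _) (hausdorffEDist_image_F_le q 2 _ _))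

/-- The Sierpinski gasket `K`: the unique nonempty compact set with
`K = F_0(K) ∪ F_1(K) ∪ F_2(K)`. -/
def gasket (q : Fin 3 → Plane) : Set Plane :=
  (ContractingWith.fixedPoint (hutchinson q) (contractingWith_hutchinson q) :
    TopologicalSpace.NonemptyCompacts Plane)

theorem isCompact_gasket (q : Fin 3 → Plane) : IsCompact (gasket q) :=
  TopologicalSpace.NonemptyCompacts.isCompact _

theorem gasket_nonempty (q : Fin 3 → Plane) : (gasket q).Nonempty :=
  TopologicalSpace.NonemptyCompacts.nonempty _

instance instCompactSpaceGasket (q : Fin 3 → Plane) : CompactSpace (gasket q) :=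
  isCompact_iff_compactSpace.mp (isCompact_gasket q)

theorem gasket_eq (q : Fin 3 → Plane) : gasket q = ⋃ i, F q i '' gasket q := by
  have h := congrArg (fun C : TopologicalSpace.NonemptyCompacts Plane => (C : Set Plane))
    (ContractingWith.fixedPoint_isFixedPt (contractingWith_hutchinson q)).symm
  simp only [hutchinson, TopologicalSpace.NonemptyCompacts.coe_sup,
    TopologicalSpace.NonemptyCompacts.coe_map] at h
  refine h.trans ?_
  ext x
  simp [gasket, Fin.exists_fin_succ]

/-- `F_w = F_{w_1} ∘ F_{w_2} ∘ ... ∘ F_{w_m}` for a word `w = w_1 w_2 ... w_m`. -/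
def wordMap (q : Fin 3 → Plane) : List (Fin 3) → Plane → Plane
  | [] => id
  | i :: w => F q i ∘ wordMap q w

/-- The vertex set `V_m = ⋃_{|w| = m} F_w(V_0)` with `V_0 = {q_0, q_1, q_2}`, as a set of points
of the gasket. -/
def V (q : Fin 3 → Plane) (m : ℕ) : Set (gasket q) :=
  {x | ∃ w : List (Fin 3), w.length = m ∧ (x : Plane) ∈ wordMap q w '' range q}

instance instFiniteV (q : Fin 3 → Plane) (m : ℕ) : Finite (V q m) := by
  have h : (⋃ w ∈ {w : List (Fin 3) | w.length = m}, wordMap q w '' range q).Finite :=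
    (List.finite_length_eq (Fin 3) m).biUnion fun w _ => (finite_range q).image _
  refine (h.preimage (f := ((↑) : gasket q → Plane))
    Subtype.val_injective.injOn).subset fun x hx => ?_
  obtain ⟨w, hw, hx⟩ := hx
  exact mem_preimage.2 (mem_biUnion (show w ∈ {w : List (Fin 3) | w.length = m} from hw) hx)

instance instFintypeV (q : Fin 3 → Plane) (m : ℕ) : Fintype (V q m) := Fintype.ofFinite _

/-- No point is lost by the restriction to the gasket in the definition of `V_m`. -/
theorem wordMap_mem_gasket (q : Fin 3 → Plane) (w : List (Fin 3)) (i : Fin 3) :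
    wordMap q w (q i) ∈ gasket q := by
  have hF : ∀ j, ∀ x ∈ gasket q, F q j x ∈ gasket q := fun j x hx => by
    rw [gasket_eq]
    exact mem_iUnion.2 ⟨j, mem_image_of_mem _ hx⟩
  induction w with
  | nil =>
    obtain ⟨x, hx⟩ := gasket_nonempty q
    have hn : ∀ n : ℕ, (1 / 2 : ℝ) ^ n • (x - q i) + q i ∈ gasket q := by
      intro n
      induction n with
      | zero => simpa using hx
      | succ n ih =>
        have := hF i _ ih
        simpa [F, pow_succ', mul_smul] using this
    have hlim : Filter.Tendsto (fun n : ℕ => (1 / 2 : ℝ) ^ n • (x - q i) + q i) Filter.atTop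
        (nhds ((0 : ℝ) • (x - q i) + q i)) :=
      ((tendsto_pow_atTop_nhds_zero_of_lt_one (by norm_num) (by norm_num)).smul_const _).add_const _
    rw [zero_smul, zero_add] at hlim
    exact (isCompact_gasket q).isClosed.mem_of_tendsto hlim (Filter.Eventually.of_forall hn)
  | cons j w ih => exact hF j _ ih

/-- The graph `G_m` on `V_m`: two distinct points are neighbours if both lie in `F_w(V_0)` for
a common word `w` of length `m`. -/
def G (q : Fin 3 → Plane) (m : ℕ) : SimpleGraph (V q m) where
  Adj x y := x ≠ y ∧ ∃ w : List (Fin 3), w.length = m ∧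
    ((x : gasket q) : Plane) ∈ wordMap q w '' range q ∧
    ((y : gasket q) : Plane) ∈ wordMap q w '' range q
  symm := ⟨fun _ _ h => ⟨h.1.symm, h.2.imp fun _ hw => ⟨hw.1, hw.2.2, hw.2.1⟩⟩⟩
  loopless := ⟨fun _ h => h.1 rfl⟩

/-- The set of edges `E_m` of `G_m` (unordered pairs of neighbours). -/
abbrev E (q : Fin 3 → Plane) (m : ℕ) : Type := (G q m).edgeSet

instance instFintypeE (q : Fin 3 → Plane) (m : ℕ) : Fintype (E q m) := Fintype.ofFinite _

open Classical in
/-- The rescaled graph energy `E_m(f) = r^{-m} ∑_{p ∈ V_m} ∑_{p' ∼_m p} (f(p) - f(p'))^2` with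
`r = 3/5`. -/
def graphEnergy (q : Fin 3 → Plane) (m : ℕ) (f : gasket q → ℝ) : ℝ :=
  ((3 / 5 : ℝ) ^ m)⁻¹ * ∑ p : V q m, ∑ p' : V q m with (G q m).Adj p p', (f p - f p') ^ 2

/-- A continuous function on `K` is `m`-piecewise harmonic if, for every `n ≥ m + 1`, it minimizes
the energy `E_n` amongst all functions on `K` which coincide with it on `V_m`. -/
def IsPiecewiseHarmonic (q : Fin 3 → Plane) (m : ℕ) (f : C(gasket q, ℝ)) : Prop :=
  ∀ n : ℕ, m + 1 ≤ n → ∀ g : gasket q → ℝ, (∀ x ∈ V q m, g x = f x) →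
    graphEnergy q n f ≤ graphEnergy q n g

open Classical in
/-- `f` is `m`-piecewise harmonic with `f(p') = δ_{p p'}` for `p' ∈ V_m`. -/
def IsHarmonicSpline (q : Fin 3 → Plane) (m : ℕ) (p : V q m) (f : C(gasket q, ℝ)) : Prop :=
  IsPiecewiseHarmonic q m f ∧ ∀ p' : V q m, f p' = if p' = p then 1 else 0

/-- The function `ψ_{p,m}`: the `m`-piecewise harmonic function with `ψ_{p,m}(p') = δ_{p p'}`
for `p' ∈ V_m`. -/
def psi (q : Fin 3 → Plane) (m : ℕ) (p : V q m) : C(gasket q, ℝ) :=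
  Classical.epsilon (IsHarmonicSpline q m p)

open Classical in
/-- The weights `c(p)`: `1/2` for `p ∈ V_0` and `1/4` otherwise. -/
def vertexWeight (q : Fin 3 → Plane) (p : gasket q) : ℝ := if p ∈ V q 0 then 1 / 2 else 1 / 4

/-- The maps `i` and `j` assigning to each edge of `G_m` its initial and its terminal vertex. -/
structure Orientation (q : Fin 3 → Plane) (m : ℕ) where
  i : E q m → V q m
  j : E q m → V q m
  ends : ∀ e : E q m, s(i e, j e) = (e : Sym2 (V q m))

instance instNonemptyOrientation (q : Fin 3 → Plane) (m : ℕ) : Nonempty (Orientation q m) :=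
  ⟨⟨fun e => (Quot.out (e : Sym2 (V q m))).1, fun e => (Quot.out (e : Sym2 (V q m))).2,
    fun e => Quot.out_eq (e : Sym2 (V q m))⟩⟩

/-- The functions `ψ_{e,m} = c(i(e)) ψ_{i(e),m} + c(j(e)) ψ_{j(e),m}`. -/
def psiEdge (q : Fin 3 → Plane) (m : ℕ) (o : Orientation q m) (e : E q m) : C(gasket q, ℝ) :=
  vertexWeight q (o.i e) • psi q m (o.i e) + vertexWeight q (o.j e) • psi q m (o.j e)

/-- The open interval `(0, 2^{-m})`. -/
abbrev EdgeInterval (m : ℕ) : Type := Ioo (0 : ℝ) ((2 : ℝ) ^ m)⁻¹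

/-- The Lebesgue measure on the interval `(0, 2^{-m})`. -/
def edgeLebesgue (m : ℕ) : Measure (EdgeInterval m) :=
  Measure.comap Subtype.val (volume : Measure ℝ)

/-- The space `X_m = V_m ∪ ⋃_e {e} × (0, 2^{-m})` (disjoint union) of the metric graph, all of
whose edges have length `2^{-m}`. Its σ-algebra is that of the disjoint union, which is the Borel
σ-algebra of the metric graph: the finite set `V_m` is closed, and each `{e} × (0, 2^{-m})` is
open and homeomorphic to the interval. -/
abbrev X (q : Fin 3 → Plane) (m : ℕ) : Type := V q m ⊕ (_ : E q m) × EdgeInterval m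

/-- The point of `X_m` at the position `t` of the edge `e`. -/
def edgePoint (q : Fin 3 → Plane) (m : ℕ) (e : E q m) (t : EdgeInterval m) : X q m :=
  Sum.inr ⟨e, t⟩

/-- The constants `c_e = 2^m ∫_K ψ_{e,m} dμ`. -/
def edgeConst (q : Fin 3 → Plane) (m : ℕ) (o : Orientation q m) (μ : Measure (gasket q))
    (e : E q m) : ℝ :=
  2 ^ m * ∫ x, psiEdge q m o e x ∂μ

/-- The measure `μ_m = ∑_e c_e λ_e` on `X_m`, where `λ_e` is the Lebesgue measure on the
edge `e`. -/
def graphMeasure (q : Fin 3 → Plane) (m : ℕ) (o : Orientation q m) (μ : Measure (gasket q)) :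
    Measure (X q m) :=
  ∑ e : E q m, ENNReal.ofReal (edgeConst q m o μ e) •
    Measure.map (edgePoint q m e) (edgeLebesgue m)

/-- The average `2^m ∫_0^{2^{-m}} f_e(s) ds` of `f` on the edge `e`. -/
def edgeAverage (q : Fin 3 → Plane) (m : ℕ) (f : X q m → ℝ) (e : E q m) : ℝ :=
  2 ^ m * ∫ s, f (edgePoint q m e s) ∂edgeLebesgue m

/-- The function `J_{0,m} f = ∑_e (average of f on e) ψ_{e,m}` on `K`. -/
def identification (q : Fin 3 → Plane) (m : ℕ) (o : Orientation q m) (f : X q m → ℝ) :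
    C(gasket q, ℝ) :=
  ∑ e : E q m, edgeAverage q m f e • psiEdge q m o e

end SG

end

/-! The constants `c_e` are chosen so that `μ_m` gives the edge `e` the mass `∫ ψ_e dμ`. The mean of
`f` over `e` is therefore the inner product of `f` with `1_e / ∫ ψ_e dμ`, and `J` is the finite rank
operator `∑_e ⟨1_e / ∫ ψ_e dμ, ·⟩ ψ_e`. Its adjoint is read off by exchanging the two factors.

The norm bound needs only `ψ_e ≥ 0` and `∑_e ψ_e ≤ 1`. With `a_e` the mean of `f` over `e`,
Cauchy-Schwarz gives `(∑ a_e ψ_e)² ≤ ∑ a_e² ψ_e`; integration leaves `∑ a_e² ∫ ψ_e dμ`, which is at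
most `‖f‖²` by Bessel's inequality for the disjoint edges. The bound `∑_e ψ_e ≤ 1` combines the
partition of unity `∑_p ψ_p = 1` with `deg(p) c(p) ≤ 1`.

Most of the work is to make `ψ_p` explicit. The gasket is coded by infinite words. Barycentric
coordinates show that a point with two addresses has exactly the addresses `v i j j j ...` and `v j
i i i ...`. The rule giving the midpoint of a side the weights 2/5, 2/5 for its ends and 1/5 for the
opposite corner defines a continuous function of addresses (`harm`). It respects this identification
and so descends to the gasket (`harmExt`).

Splitting one cell gives energy 3/5 of the old one plus a positive definite form in the deviation
from this rule (`sum_cellEnergy_eq`). So the graph energies increase with the level, and a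
continuous function is `m`-piecewise harmonic exactly if it obeys the rule at every level from `m`
on. This yields existence and, by density of the vertices, uniqueness of the splines. -/

namespace SG

open Filter Topology

/-! ### Symbolic coding of the gasket -/

/-- The point of the plane with address `ω`. -/
noncomputable def point (q : Fin 3 → Plane) (ω : ℕ → Fin 3) : Plane :=
  ∑' n, (1 / 2 : ℝ) ^ (n + 1) • q (ω n)

theorem norm_vertex_le (q : Fin 3 → Plane) (i : Fin 3) : ‖q i‖ ≤ ∑ j, ‖q j‖ :=
  Finset.single_le_sum (f := fun j => ‖q j‖) (fun _ _ => norm_nonneg _) (Finset.mem_univ i)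

theorem norm_point_term_le (q : Fin 3 → Plane) (ω : ℕ → Fin 3) (n : ℕ) :
    ‖(1 / 2 : ℝ) ^ (n + 1) • q (ω n)‖ ≤ (1 / 2 : ℝ) ^ (n + 1) * ∑ j, ‖q j‖ := by
  rw [norm_smul, Real.norm_of_nonneg (by positivity)]
  exact mul_le_mul_of_nonneg_left (norm_vertex_le q _) (by positivity)

theorem summable_half_pow_succ_mul (c : ℝ) :
    Summable fun n : ℕ => (1 / 2 : ℝ) ^ (n + 1) * c :=
  ((summable_nat_add_iff 1).2 summable_geometric_two).mul_right c

theorem summable_point (q : Fin 3 → Plane) (ω : ℕ → Fin 3) :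
    Summable fun n => (1 / 2 : ℝ) ^ (n + 1) • q (ω n) :=
  (summable_half_pow_succ_mul _).of_norm_bounded (norm_point_term_le q ω)

theorem continuous_point (q : Fin 3 → Plane) : Continuous (point q) :=
  have hq : Continuous q := continuous_of_discreteTopology
  continuous_tsum (fun n => by fun_prop) (summable_half_pow_succ_mul _) (fun n ω => norm_point_term_le q ω n)

theorem point_eq_F (q : Fin 3 → Plane) (ω : ℕ → Fin 3) :
    point q ω = F q (ω 0) (point q fun n => ω (n + 1)) := by
  rw [point, (summable_point q ω).tsum_eq_zero_add]
  have : ∀ n : ℕ, (1 / 2 : ℝ) ^ (n + 1 + 1) • q (ω (n + 1))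
      = (1 / 2 : ℝ) • ((1 / 2 : ℝ) ^ (n + 1) • q (ω (n + 1))) := fun n => by
    rw [smul_smul, pow_succ' _ (n + 1)]
  simp_rw [this]
  rw [(summable_point q fun n => ω (n + 1)).tsum_const_smul, F, point]
  module

theorem point_const (q : Fin 3 → Plane) (i : Fin 3) : point q (fun _ => i) = q i := by
  have h := point_eq_F q (fun _ => i)
  rw [F] at h
  set x := point q fun _ => i
  have h2 : (1 / 2 : ℝ) • (x - q i) = 0 := by
    calc (1 / 2 : ℝ) • (x - q i) = x - ((1 / 2 : ℝ) • (x - q i) + q i) := by module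
      _ = 0 := sub_eq_zero.2 h
  exact sub_eq_zero.1 ((smul_eq_zero.1 h2).resolve_left (by norm_num))

/-- The set of coded points is compact and invariant under the Hutchinson operator, whose fixed
point is unique. -/
theorem range_point (q : Fin 3 → Plane) : range (point q) = gasket q := by
  let C : TopologicalSpace.NonemptyCompacts Plane :=
    ⟨⟨range (point q), isCompact_range (continuous_point q)⟩, range_nonempty _⟩
  have hC : Function.IsFixedPt (hutchinson q) C := by
    apply TopologicalSpace.NonemptyCompacts.ext
    have : (hutchinson q C : Set Plane) = ⋃ i, F q i '' range (point q) := by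
      ext x
      simp [hutchinson, C, Fin.exists_fin_succ]
    rw [this]
    ext x
    simp only [mem_iUnion, mem_image, mem_range, exists_exists_eq_and]
    constructor
    · rintro ⟨i, ω, rfl⟩
      let σ : ℕ → Fin 3 := fun n => n.casesOn i ω
      have h : point q σ = F q i (point q ω) := point_eq_F q σ
      exact ⟨σ, h⟩
    · rintro ⟨ω, rfl⟩
      exact ⟨ω 0, _, (point_eq_F q ω).symm⟩
  rw [gasket, ← (contractingWith_hutchinson q).fixedPoint_unique hC]
  rfl

theorem F_injective (q : Fin 3 → Plane) (i : Fin 3) : Function.Injective (F q i) := fun x y h => by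
  simpa [F] using h

theorem wordMap_injective (q : Fin 3 → Plane) (w : List (Fin 3)) :
    Function.Injective (wordMap q w) := by
  induction w with
  | nil => exact Function.injective_id
  | cons i w ih => exact (F_injective q i).comp ih

theorem wordMap_append (q : Fin 3 → Plane) (v w : List (Fin 3)) (x : Plane) :
    wordMap q (v ++ w) x = wordMap q v (wordMap q w x) := by
  induction v with
  | nil => rfl
  | cons i v ih => simp [wordMap, ih]

theorem point_eq_wordMap (q : Fin 3 → Plane) (m : ℕ) (ω : ℕ → Fin 3) :
    point q ω = wordMap q (List.ofFn fun k : Fin m => ω k) (point q fun n => ω (n + m)) := by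
  induction m generalizing ω with
  | zero => simp [wordMap]
  | succ m ih =>
    rw [point_eq_F, ih (fun n => ω (n + 1)), List.ofFn_succ]
    simp only [wordMap, Function.comp, Fin.val_zero, Fin.val_succ]
    congr 3

/-- The address `w i i i ...` of the vertex `F_w(q_i)`. -/
def code (w : List (Fin 3)) (i : Fin 3) (n : ℕ) : Fin 3 := w.getD n i

theorem point_code (q : Fin 3 → Plane) (w : List (Fin 3)) (i : Fin 3) :
    point q (code w i) = wordMap q w (q i) := by
  induction w with
  | nil => exact point_const q i
  | cons j w ih =>
    rw [point_eq_F]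
    exact congrArg (F q j) ih

theorem code_of_length_le {w : List (Fin 3)} {i : Fin 3} {n : ℕ} (h : w.length ≤ n) :
    code w i n = i := by
  rw [code, List.getD_eq_default _ _ h]

theorem code_injective {w w' : List (Fin 3)} {i i' : Fin 3} (hw : w.length = w'.length)
    (h : code w i = code w' i') : w = w' ∧ i = i' := by
  refine ⟨List.ext_getElem hw fun n h1 h2 => ?_, ?_⟩
  · have := congrFun h n
    rwa [code, code, List.getD_eq_getElem _ _ h1, List.getD_eq_getElem _ _ h2] at this
  · have := congrFun h w.length
    rwa [code_of_length_le le_rfl, code_of_length_le hw.ge] at this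

theorem code_eq_of_length {w : List (Fin 3)} {n : ℕ} (i j : Fin 3) (h : n < w.length) :
    code w i n = code w j n := by
  rw [code, code, List.getD_eq_getElem _ _ h, List.getD_eq_getElem _ _ h]

/-! ### Barycentric coordinates -/

/-- The barycentric coordinate of the triangle `q` that is `1` at `q k` (if the triangle is
equilateral of side length `1`). -/
noncomputable def bary (q : Fin 3 → Plane) (k : Fin 3) (x : Plane) : ℝ :=
  (2 / 3) * inner ℝ (x - q (k + 1)) ((q k - q (k + 1)) + (q k - q (k + 2)))

theorem continuous_bary (q : Fin 3 → Plane) (k : Fin 3) : Continuous (bary q k) := by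
  unfold bary
  fun_prop

theorem bary_F (q : Fin 3 → Plane) (k i : Fin 3) (x : Plane) :
    bary q k (F q i x) = bary q k x / 2 + bary q k (q i) / 2 := by
  have : F q i x - q (k + 1) = (1 / 2 : ℝ) • (x - q (k + 1)) + (1 / 2 : ℝ) • (q i - q (k + 1)) := by
    rw [F]; module
  rw [bary, this, inner_add_left, inner_smul_left, inner_smul_left, bary, bary]
  simp
  ring

/-- The two sides `u`, `v` issuing from `q k` are unit vectors with `⟨u, v⟩ = 1/2`. Hence `⟨u, u +
v⟩ = 3/2`, which the factor `2/3` normalises, and `u + v` is orthogonal to the opposite side `u -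
v`. -/
theorem bary_vertex {q : Fin 3 → Plane} (hq : ∀ k l : Fin 3, k ≠ l → dist (q k) (q l) = 1)
    (k i : Fin 3) : bary q k (q i) = if k = i then 1 else 0 := by
  obtain ⟨hi, hk1, hk2, hk3⟩ : (i = k ∨ i = k + 1 ∨ i = k + 2) ∧
      k ≠ k + 1 ∧ k ≠ k + 2 ∧ k + 2 ≠ k + 1 := by revert i k; decide
  have h1 := hq _ _ hk1
  have h2 := hq _ _ hk2
  have h3 := hq _ _ hk3
  rw [dist_eq_norm] at h1 h2 h3
  rw [← sub_sub_sub_cancel_left (q (k + 1)) (q (k + 2)) (q k)] at h3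
  have h4 := norm_sub_sq_real (q k - q (k + 1)) (q k - q (k + 2))
  rw [h1, h2, h3] at h4
  rcases hi with rfl | rfl | rfl
  · rw [bary, inner_add_right, real_inner_self_eq_norm_sq, h1, if_pos rfl]
    linarith
  · rw [bary, sub_self, inner_zero_left, if_neg hk1, mul_zero]
  · rw [bary, ← sub_sub_sub_cancel_left (q (k + 1)) (q (k + 2)) (q k), if_neg hk2]
    generalize q k - q (k + 1) = u at *
    generalize q k - q (k + 2) = v at *
    rw [inner_add_right, inner_sub_left, inner_sub_left, real_inner_self_eq_norm_sq,
      real_inner_self_eq_norm_sq, real_inner_comm, h1, h2]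
    ring

/-- A minimiser has the form `F_i(y)`, so the minimum is the average of the value at `y`, which is
no smaller, and a vertex value in `{0, 1}`; this forces it to be nonnegative. The maximum is treated
alike. -/
theorem bary_mem_Icc {q : Fin 3 → Plane} (hq : ∀ k l : Fin 3, k ≠ l → dist (q k) (q l) = 1)
    (k : Fin 3) {x : Plane} (hx : x ∈ gasket q) : bary q k x ∈ Icc (0 : ℝ) 1 := by
  have hv : ∀ i, 0 ≤ bary q k (q i) ∧ bary q k (q i) ≤ 1 := fun i => by
    rw [bary_vertex hq]; split_ifs <;> norm_num
  obtain ⟨a, ha, hamin⟩ := (isCompact_gasket q).exists_isMinOn (gasket_nonempty q)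
    (continuous_bary q k).continuousOn
  obtain ⟨b, hb, hbmax⟩ := (isCompact_gasket q).exists_isMaxOn (gasket_nonempty q)
    (continuous_bary q k).continuousOn
  constructor
  · refine le_trans ?_ (hamin hx)
    rw [gasket_eq] at ha
    obtain ⟨i, y, hy, rfl⟩ := mem_iUnion.1 ha
    have h1 : bary q k (F q i y) ≤ bary q k y := hamin hy
    have h2 := bary_F q k i y
    linarith [hv i]
  · refine le_trans (hbmax hx) ?_
    rw [gasket_eq] at hb
    obtain ⟨i, y, hy, rfl⟩ := mem_iUnion.1 hb
    have h1 : bary q k y ≤ bary q k (F q i y) := hbmax hy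
    have h2 := bary_F q k i y
    linarith [hv i]

theorem point_mem_gasket (q : Fin 3 → Plane) (ω : ℕ → Fin 3) : point q ω ∈ gasket q := by
  rw [← range_point]
  exact mem_range_self ω

/-- The value 1 is the average of a vertex value and the value at the shifted address, both at most
1, so both equal 1 and the argument repeats along the address. -/
theorem eq_const_of_bary_point_eq_one {q : Fin 3 → Plane}
    (hq : ∀ k l : Fin 3, k ≠ l → dist (q k) (q l) = 1) {i : Fin 3} (n : ℕ) {ω : ℕ → Fin 3}
    (h : bary q i (point q ω) = 1) : ω n = i := by
  have hstep : ∀ {ω : ℕ → Fin 3}, bary q i (point q ω) = 1 →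
      ω 0 = i ∧ bary q i (point q fun n => ω (n + 1)) = 1 := fun {ω} h => by
    have h1 := bary_F q i (ω 0) (point q fun n => ω (n + 1))
    rw [← point_eq_F, h, bary_vertex hq] at h1
    have h2 := (bary_mem_Icc hq i (point_mem_gasket q fun n => ω (n + 1))).2
    by_cases h0 : i = ω 0
    · rw [if_pos h0] at h1
      exact ⟨h0.symm, by linarith⟩
    · rw [if_neg h0] at h1
      linarith
  induction n generalizing ω with
  | zero => exact (hstep h).1
  | succ n ih => exact ih (hstep h).2

/-- The `i`-th coordinate is at least 1/2 on the cell `i` and at most 1/2 on the cell `j`. At a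
common point it equals 1/2, so it is 1 at the point coded by `τ`. -/
theorem eq_const_of_F_point_eq {q : Fin 3 → Plane}
    (hq : ∀ k l : Fin 3, k ≠ l → dist (q k) (q l) = 1) {i j : Fin 3} (hij : i ≠ j)
    {σ τ : ℕ → Fin 3} (h : F q i (point q σ) = F q j (point q τ)) (n : ℕ) : τ n = i := by
  have h1 := bary_F q i i (point q σ)
  have h2 := bary_F q i j (point q τ)
  rw [bary_vertex hq] at h1 h2
  rw [if_pos rfl] at h1
  rw [if_neg hij, ← h, h1] at h2
  refine eq_const_of_bary_point_eq_one hq n ?_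
  linarith [(bary_mem_Icc hq i (point_mem_gasket q σ)).1,
    (bary_mem_Icc hq i (point_mem_gasket q τ)).2]

/-- Two addresses of the same point are `v i j j j ...` and `v j i i i ...`. -/
theorem exists_branch_of_point_eq {q : Fin 3 → Plane}
    (hq : ∀ k l : Fin 3, k ≠ l → dist (q k) (q l) = 1) {ω ω' : ℕ → Fin 3}
    (h : point q ω = point q ω') (hne : ω ≠ ω') :
    ∃ n, (∀ k < n, ω k = ω' k) ∧ ω n ≠ ω' n ∧ (∀ k, n < k → ω k = ω' n) ∧
      ∀ k, n < k → ω' k = ω n := by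
  classical
  have hex : ∃ n, ω n ≠ ω' n := by
    by_contra! hall
    exact hne (funext hall)
  have hlt : ∀ k < Nat.find hex, ω k = ω' k := fun k hk => not_not.1 (Nat.find_min hex hk)
  have hn := Nat.find_spec hex
  generalize Nat.find hex = n at hlt hn
  -- Cancelling the common prefix leaves a common point of two different first level cells.
  have hpre : (List.ofFn fun k : Fin n => ω k) = List.ofFn fun k : Fin n => ω' k :=
    congrArg List.ofFn (funext fun k => hlt k k.2)
  rw [point_eq_wordMap q n ω, point_eq_wordMap q n ω', hpre] at h
  have h1 := wordMap_injective q _ h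
  rw [point_eq_F, point_eq_F q (fun k => ω' (k + n))] at h1
  simp only [zero_add] at h1
  refine ⟨n, hlt, hn, fun k hk => ?_, fun k hk => ?_⟩
  · obtain ⟨d, rfl⟩ := Nat.exists_eq_add_of_lt hk
    have := eq_const_of_F_point_eq hq hn.symm h1.symm d
    rwa [show d + 1 + n = n + d + 1 by ring] at this
  · obtain ⟨d, rfl⟩ := Nat.exists_eq_add_of_lt hk
    have := eq_const_of_F_point_eq hq hn h1 d
    rwa [show d + 1 + n = n + d + 1 by ring] at this

/-- A vertex of the initial triangle has only one address. -/
theorem eq_const_of_point_eq_vertex {q : Fin 3 → Plane}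
    (hq : ∀ k l : Fin 3, k ≠ l → dist (q k) (q l) = 1) {ω : ℕ → Fin 3} {i : Fin 3}
    (h : point q ω = q i) : ω = fun _ => i := by
  by_contra hne
  obtain ⟨n, -, hn, -, h2⟩ := exists_branch_of_point_eq hq (h.trans (point_const q i).symm) hne
  exact hn (h2 (n + 1) n.lt_succ_self).symm

/-- A point of the gasket has at most two addresses. -/
theorem point_code_unique {q : Fin 3 → Plane}
    (hq : ∀ k l : Fin 3, k ≠ l → dist (q k) (q l) = 1) {ω ω₁ ω₂ : ℕ → Fin 3}
    (h1 : point q ω = point q ω₁) (h2 : point q ω = point q ω₂) (hne1 : ω ≠ ω₁) (hne2 : ω ≠ ω₂) :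
    ω₁ = ω₂ := by
  obtain ⟨n, ha, hb, hc, hd⟩ := exists_branch_of_point_eq hq h1 hne1
  obtain ⟨n', ha', hb', hc', hd'⟩ := exists_branch_of_point_eq hq h2 hne2
  -- Past its branching index `ω` is constant. Were the indices different, `ω` would already be
  -- constant when reaching the larger one, and could not branch there.
  have hnn : n = n' := by
    rcases lt_trichotomy n n' with hlt | heq | hlt
    · exact absurd ((hc n' hlt).trans ((hc (n' + 1) (by omega)).symm.trans (hc' _ (by omega)))) hb'
    · exact heq
    · exact absurd ((hc' n hlt).trans ((hc' (n + 1) (by omega)).symm.trans (hc _ (by omega)))) hb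
  subst hnn
  funext k
  rcases lt_trichotomy k n with hlt | rfl | hlt
  · rw [← ha k hlt, ha' k hlt]
  · rw [← hc (k + 1) (by omega), hc' (k + 1) (by omega)]
  · rw [hd k hlt, hd' k hlt]

/-! ### Harmonic extension on addresses -/

/-- One step of the harmonic extension algorithm: the values at the vertices of the cell `i` of
the harmonic function with values `a` at the vertices of the triangle. -/
noncomputable def harmStep (i : Fin 3) (a : Fin 3 → ℝ) (j : Fin 3) : ℝ :=
  if j = i then a i else (a i + a j + ∑ k, a k) / 5

/-- The values at the vertices of the cell `w` of the harmonic function with values `a` at the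
vertices of the triangle. -/
noncomputable def harmIter (w : List (Fin 3)) (a : Fin 3 → ℝ) : Fin 3 → ℝ :=
  w.foldl (fun b i => harmStep i b) a

/-- The value at the address `ω` of the harmonic function with values `a` at the vertices of the
triangle. -/
noncomputable def harm (a : Fin 3 → ℝ) (ω : ℕ → Fin 3) : ℝ :=
  limUnder atTop fun n : ℕ => harmIter (List.ofFn fun k : Fin n => ω k) a 0

theorem harmStep_self (i : Fin 3) (a : Fin 3 → ℝ) : harmStep i a i = a i := if_pos rfl

/-- Both sides are the value at the midpoint shared by the cells `i` and `j`; this symmetry lets the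
extension descend to the gasket. -/
theorem harmStep_comm (i j : Fin 3) (a : Fin 3 → ℝ) : harmStep i a j = harmStep j a i := by
  by_cases h : j = i
  · rw [h]
  · rw [harmStep, harmStep, if_neg h, if_neg (Ne.symm h), add_comm (a i)]

theorem harmIter_append (v w : List (Fin 3)) (a : Fin 3 → ℝ) :
    harmIter (v ++ w) a = harmIter w (harmIter v a) :=
  List.foldl_append

theorem harmIter_ofFn_succ (a : Fin 3 → ℝ) (ω : ℕ → Fin 3) (n : ℕ) :
    harmIter (List.ofFn fun k : Fin (n + 1) => ω k) a =
      harmStep (ω n) (harmIter (List.ofFn fun k : Fin n => ω k) a) := by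
  rw [List.ofFn_succ', List.concat_eq_append, harmIter_append]
  simp [harmIter]

theorem harmIter_ofFn_succ' (a : Fin 3 → ℝ) (ω : ℕ → Fin 3) (n : ℕ) :
    harmIter (List.ofFn fun k : Fin (n + 1) => ω k) a =
      harmIter (List.ofFn fun k : Fin n => ω (k + 1)) (harmStep (ω 0) a) := by
  rw [List.ofFn_succ]
  simp [harmIter]

/-- The difference between the old corner `l` and a new one is `(2(a l - a j) + (a l - a k)) / 5`,
at most `3D/5`; two new corners differ by only a fifth of an old difference. -/
theorem abs_harmStep_sub_le {a : Fin 3 → ℝ} {D : ℝ} (h : ∀ i j, |a i - a j| ≤ D) (l i j : Fin 3) :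
    |harmStep l a i - harmStep l a j| ≤ 3 / 5 * D := by
  have h01 := abs_le.1 (h 0 1)
  have h02 := abs_le.1 (h 0 2)
  have h12 := abs_le.1 (h 1 2)
  have hD : 0 ≤ D := (abs_nonneg _).trans (h 0 0)
  rw [abs_le]
  fin_cases l <;> fin_cases i <;> fin_cases j <;>
    simp only [harmStep, Fin.sum_univ_three, Fin.reduceFinMk, Fin.zero_eta, Fin.mk_one,
      Fin.reduceEq, Fin.isValue, if_true, if_false] <;> constructor <;> linarith

/-- The oscillation of boundary values. -/
theorem exists_abs_sub_le (a : Fin 3 → ℝ) : ∃ D, ∀ i j, |a i - a j| ≤ D :=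
  ⟨∑ i, ∑ j, |a i - a j|, fun i j =>
    (Finset.single_le_sum (f := fun j => |a i - a j|) (fun _ _ => abs_nonneg _)
      (Finset.mem_univ j)).trans
    (Finset.single_le_sum (f := fun i => ∑ j, |a i - a j|)
      (fun _ _ => Finset.sum_nonneg fun _ _ => abs_nonneg _) (Finset.mem_univ i))⟩

theorem abs_harmIter_sub_le {a : Fin 3 → ℝ} {D : ℝ} (h : ∀ i j, |a i - a j| ≤ D)
    (ω : ℕ → Fin 3) (n : ℕ) (i j : Fin 3) :
    |harmIter (List.ofFn fun k : Fin n => ω k) a i -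
      harmIter (List.ofFn fun k : Fin n => ω k) a j| ≤ D * (3 / 5) ^ n := by
  induction n generalizing i j with
  | zero => simpa [harmIter] using h i j
  | succ n ih =>
    rw [harmIter_ofFn_succ]
    refine (abs_harmStep_sub_le ih _ i j).trans_eq ?_
    ring

/-- Successive cells share the corner `ω n`. Passing through its value costs one oscillation of each
cell, whence the factor 2. -/
theorem dist_harmIter_succ_le {a : Fin 3 → ℝ} {D : ℝ} (h : ∀ i j, |a i - a j| ≤ D)
    (ω : ℕ → Fin 3) (n : ℕ) :
    dist (harmIter (List.ofFn fun k : Fin n => ω k) a 0)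
      (harmIter (List.ofFn fun k : Fin (n + 1) => ω k) a 0) ≤ 2 * D * (3 / 5) ^ n := by
  have h1 := abs_harmIter_sub_le h ω n 0 (ω n)
  have h2 := abs_harmIter_sub_le h ω (n + 1) (ω n) 0
  have h3 : harmIter (List.ofFn fun k : Fin (n + 1) => ω k) a (ω n) =
      harmIter (List.ofFn fun k : Fin n => ω k) a (ω n) := by
    rw [harmIter_ofFn_succ, harmStep_self]
  rw [h3] at h2
  have hD : 0 ≤ D := (abs_nonneg _).trans (h 0 0)
  have h4 : D * (3 / 5) ^ (n + 1) ≤ D * (3 / 5) ^ n :=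
    mul_le_mul_of_nonneg_left (pow_le_pow_of_le_one (by norm_num) (by norm_num) n.le_succ) hD
  rw [Real.dist_eq]
  refine (abs_sub_le _ (harmIter (List.ofFn fun k : Fin n => ω k) a (ω n)) _).trans ?_
  linarith

theorem tendsto_harmIter_zero (a : Fin 3 → ℝ) (ω : ℕ → Fin 3) :
    Tendsto (fun n : ℕ => harmIter (List.ofFn fun k : Fin n => ω k) a 0) atTop
      (𝓝 (harm a ω)) := by
  obtain ⟨D, hD⟩ := exists_abs_sub_le a
  exact (cauchySeq_of_le_geometric _ _ (by norm_num) (dist_harmIter_succ_le hD ω)).tendsto_limUnder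

/-- The corner 0 in the definition of `harm` is immaterial, since the oscillation over the cells
tends to 0. -/
theorem tendsto_harmIter (a : Fin 3 → ℝ) (ω : ℕ → Fin 3) (i : Fin 3) :
    Tendsto (fun n : ℕ => harmIter (List.ofFn fun k : Fin n => ω k) a i) atTop
      (𝓝 (harm a ω)) := by
  obtain ⟨D, hD⟩ := exists_abs_sub_le a
  have h0 : Tendsto (fun n : ℕ => D * (3 / 5 : ℝ) ^ n) atTop (𝓝 0) := by
    simpa using (tendsto_pow_atTop_nhds_zero_of_lt_one (by norm_num : (0 : ℝ) ≤ 3 / 5)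
      (by norm_num)).const_mul D
  have h1 := squeeze_zero_norm (fun n => (Real.norm_eq_abs _).trans_le
    (abs_harmIter_sub_le hD ω n i 0)) h0
  simpa using h1.add (tendsto_harmIter_zero a ω)

theorem harm_eq_tail (a : Fin 3 → ℝ) (ω : ℕ → Fin 3) :
    harm a ω = harm (harmStep (ω 0) a) fun n => ω (n + 1) := by
  refine tendsto_nhds_unique ((tendsto_add_atTop_iff_nat 1).2 (tendsto_harmIter a ω 0)) ?_
  simp_rw [harmIter_ofFn_succ']
  exact tendsto_harmIter _ (fun n => ω (n + 1)) 0

theorem harm_eq_shift (a : Fin 3 → ℝ) (ω : ℕ → Fin 3) (d : ℕ) :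
    harm a ω = harm (harmIter (List.ofFn fun k : Fin d => ω k) a) fun n => ω (n + d) := by
  induction d with
  | zero => rfl
  | succ d ih =>
    rw [ih, harm_eq_tail, harmIter_ofFn_succ]
    simp only [zero_add, add_right_comm, add_assoc]

theorem harm_const (a : Fin 3 → ℝ) (i : Fin 3) : harm a (fun _ => i) = a i := by
  refine tendsto_nhds_unique (tendsto_harmIter a (fun _ => i) i) ?_
  have : ∀ n : ℕ, harmIter (List.ofFn fun _ : Fin n => i) a i = a i := fun n => by
    induction n with
    | zero => rfl
    | succ n ih => rw [harmIter_ofFn_succ a (fun _ => i), harmStep_self, ih]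
  simp_rw [this]
  exact tendsto_const_nhds

theorem harm_code (a : Fin 3 → ℝ) (w : List (Fin 3)) (i : Fin 3) :
    harm a (code w i) = harmIter w a i := by
  induction w generalizing a with
  | nil => exact harm_const a i
  | cons j w ih =>
    rw [harm_eq_tail]
    exact ih _

theorem harmIter_sum {ι : Type*} (s : Finset ι) (f : ι → Fin 3 → ℝ) (w : List (Fin 3)) :
    harmIter w (∑ p ∈ s, f p) = ∑ p ∈ s, harmIter w (f p) := by
  have hstep : ∀ (i : Fin 3) (g : ι → Fin 3 → ℝ),
      harmStep i (∑ p ∈ s, g p) = ∑ p ∈ s, harmStep i (g p) := fun i g => by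
    funext j
    simp only [harmStep, Finset.sum_apply]
    split_ifs
    · rfl
    · rw [Finset.sum_comm, ← Finset.sum_add_distrib, ← Finset.sum_add_distrib, Finset.sum_div]
  induction w generalizing f with
  | nil => rfl
  | cons i w ih => simpa [harmIter, hstep] using ih fun p => harmStep i (f p)

theorem harm_sum {ι : Type*} (s : Finset ι) (f : ι → Fin 3 → ℝ) (ω : ℕ → Fin 3) :
    harm (∑ p ∈ s, f p) ω = ∑ p ∈ s, harm (f p) ω := by
  refine tendsto_nhds_unique (tendsto_harmIter _ ω 0) ?_
  simp_rw [harmIter_sum, Finset.sum_apply]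
  exact tendsto_finsetSum _ fun p _ => tendsto_harmIter _ ω 0

theorem harm_one (ω : ℕ → Fin 3) : harm 1 ω = 1 := by
  refine tendsto_nhds_unique (tendsto_harmIter _ ω 0) ?_
  have hstep : ∀ i, harmStep i 1 = 1 := fun i => by
    funext j
    simp only [harmStep, Pi.one_apply, Fin.sum_univ_three]
    norm_num
  have : ∀ w, harmIter w 1 = 1 := fun w => by
    induction w with
    | nil => rfl
    | cons i w ih => simpa [harmIter, hstep] using ih
  simp_rw [this]
  exact tendsto_const_nhds

theorem harm_nonneg {a : Fin 3 → ℝ} (ha : ∀ i, 0 ≤ a i) (ω : ℕ → Fin 3) : 0 ≤ harm a ω := by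
  refine ge_of_tendsto' (tendsto_harmIter a ω 0) fun n => ?_
  have hstep : ∀ (i : Fin 3) (b : Fin 3 → ℝ), (∀ j, 0 ≤ b j) → ∀ j, 0 ≤ harmStep i b j :=
    fun i b hb j => by
      rw [harmStep]
      have := Finset.sum_nonneg fun k (_ : k ∈ Finset.univ) => hb k
      have := hb i
      have := hb j
      split_ifs <;> positivity
  have : ∀ w (b : Fin 3 → ℝ), (∀ j, 0 ≤ b j) → ∀ j, 0 ≤ harmIter w b j := fun w => by
    induction w with
    | nil => exact fun b hb => hb
    | cons i w ih => exact fun b hb => ih _ (hstep i b hb)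
  exact this _ a ha 0

/-- The approximants depend on finitely many letters, hence are continuous, and they converge
uniformly at a geometric rate. -/
theorem continuous_harm (a : Fin 3 → ℝ) : Continuous (harm a) := by
  obtain ⟨D, hD⟩ := exists_abs_sub_le a
  have hu : TendstoUniformly (fun (n : ℕ) ω => harmIter (List.ofFn fun k : Fin n => ω k) a 0)
      (harm a) atTop := by
    have h0 : Tendsto (fun n : ℕ => 2 * D * (3 / 5 : ℝ) ^ n / (1 - 3 / 5)) atTop (𝓝 0) := by
      simpa using ((tendsto_pow_atTop_nhds_zero_of_lt_one (by norm_num : (0 : ℝ) ≤ 3 / 5)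
        (by norm_num)).const_mul (2 * D)).div_const (1 - 3 / 5)
    rw [Metric.tendstoUniformly_iff]
    intro ε hε
    filter_upwards [h0.eventually (gt_mem_nhds hε)] with n hn ω
    rw [dist_comm]
    exact (dist_le_of_le_geometric_of_tendsto _ _ (by norm_num) (dist_harmIter_succ_le hD ω)
      (tendsto_harmIter a ω 0) n).trans_lt hn
  refine hu.continuous (Frequently.of_forall fun n => ?_)
  have h1 : Continuous fun σ : Fin n → Fin 3 => harmIter (List.ofFn σ) a 0 :=
    continuous_of_discreteTopology
  exact h1.comp (continuous_pi fun k => continuous_apply (k : ℕ))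

/-- After the common prefix and one more letter both addresses are constant, so the two values are
those compared in `harmStep_comm`. -/
theorem harm_eq_of_point_eq {q : Fin 3 → Plane}
    (hq : ∀ k l : Fin 3, k ≠ l → dist (q k) (q l) = 1) (a : Fin 3 → ℝ) {ω ω' : ℕ → Fin 3}
    (h : point q ω = point q ω') : harm a ω = harm a ω' := by
  by_cases hne : ω = ω'
  · rw [hne]
  obtain ⟨n, h1, -, h2, h3⟩ := exists_branch_of_point_eq hq h hne
  have hpre : (List.ofFn fun k : Fin n => ω k) = List.ofFn fun k : Fin n => ω' k :=
    congrArg List.ofFn (funext fun k => h1 k k.2)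
  have h4 : (fun k => ω (k + 1 + n)) = fun _ => ω' n := funext fun k => h2 _ (by omega)
  have h5 : (fun k => ω' (k + 1 + n)) = fun _ => ω n := funext fun k => h3 _ (by omega)
  rw [harm_eq_shift a ω n, harm_eq_shift a ω' n, hpre, harm_eq_tail,
    harm_eq_tail _ fun k => ω' (k + n), h4, h5, harm_const, harm_const, zero_add, harmStep_comm]

/-! ### Piecewise harmonic extension on the gasket -/

/-- The vertex `F_w(q_i)` as a point of the gasket. -/
noncomputable def vertex (q : Fin 3 → Plane) (w : List (Fin 3)) (i : Fin 3) : gasket q :=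
  ⟨wordMap q w (q i), wordMap_mem_gasket q w i⟩

/-- The point of the gasket with address `ω`. -/
noncomputable def gasketPoint (q : Fin 3 → Plane) (ω : ℕ → Fin 3) : gasket q :=
  ⟨point q ω, point_mem_gasket q ω⟩

theorem gasketPoint_code (q : Fin 3 → Plane) (w : List (Fin 3)) (i : Fin 3) :
    gasketPoint q (code w i) = vertex q w i :=
  Subtype.ext (point_code q w i)

theorem gasketPoint_surjective (q : Fin 3 → Plane) : Function.Surjective (gasketPoint q) :=
  fun ⟨x, hx⟩ => by
    rw [← range_point] at hx
    obtain ⟨ω, rfl⟩ := hx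
    exact ⟨ω, rfl⟩

theorem continuous_gasketPoint (q : Fin 3 → Plane) : Continuous (gasketPoint q) :=
  (continuous_point q).subtype_mk _

/-- The value at the address `ω` of the piecewise harmonic function that agrees with `v` at the
vertices of level `m`. -/
noncomputable def codeExt (q : Fin 3 → Plane) (m : ℕ) (v : gasket q → ℝ) (ω : ℕ → Fin 3) : ℝ :=
  harm (fun i => v (vertex q (List.ofFn fun k : Fin m => ω k) i)) fun n => ω (n + m)

theorem codeExt_eq_of_eventually_const (q : Fin 3 → Plane) {m : ℕ} (v : gasket q → ℝ)
    {ω : ℕ → Fin 3} {j : Fin 3} (h : ∀ k, m ≤ k → ω k = j) :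
    codeExt q m v ω = v (gasketPoint q ω) := by
  have h1 : (fun n => ω (n + m)) = fun _ => j := funext fun n => h _ (by omega)
  rw [codeExt, h1, harm_const]
  congr 1
  apply Subtype.ext
  simp only [gasketPoint, vertex]
  rw [point_eq_wordMap q m ω, h1, point_const]

/-- If the addresses branch before level `m`, the point is a vertex of level `m` and both values are
the prescribed one. Otherwise both addresses run in the same cell of level `m`, where
`harm_eq_of_point_eq` applies. -/
theorem codeExt_eq_of_point_eq {q : Fin 3 → Plane}
    (hq : ∀ k l : Fin 3, k ≠ l → dist (q k) (q l) = 1) (m : ℕ) (v : gasket q → ℝ)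
    {ω ω' : ℕ → Fin 3} (h : gasketPoint q ω = gasketPoint q ω') :
    codeExt q m v ω = codeExt q m v ω' := by
  by_cases hne : ω = ω'
  · rw [hne]
  have hp : point q ω = point q ω' := congrArg Subtype.val h
  obtain ⟨n, h1, -, h2, h3⟩ := exists_branch_of_point_eq hq hp hne
  by_cases hn : n < m
  · rw [codeExt_eq_of_eventually_const q v fun k hk => h2 k (by omega),
      codeExt_eq_of_eventually_const q v fun k hk => h3 k (by omega), h]
  · have hpre : (List.ofFn fun k : Fin m => ω k) = List.ofFn fun k : Fin m => ω' k :=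
      congrArg List.ofFn (funext fun k => h1 k (by omega))
    rw [point_eq_wordMap q m ω, point_eq_wordMap q m ω', hpre] at hp
    rw [codeExt, codeExt, hpre]
    exact harm_eq_of_point_eq hq _ (wordMap_injective q _ hp)

/-- The piecewise harmonic function that agrees with `v` at the vertices of level `m`. -/
noncomputable def harmExt (q : Fin 3 → Plane) (m : ℕ) (v : gasket q → ℝ) (x : gasket q) : ℝ :=
  codeExt q m v (Function.surjInv (gasketPoint_surjective q) x)

theorem harmExt_gasketPoint {q : Fin 3 → Plane}
    (hq : ∀ k l : Fin 3, k ≠ l → dist (q k) (q l) = 1) (m : ℕ) (v : gasket q → ℝ)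
    (ω : ℕ → Fin 3) : harmExt q m v (gasketPoint q ω) = codeExt q m v ω :=
  codeExt_eq_of_point_eq hq m v (Function.surjInv_eq _ _)

theorem continuous_codeExt (q : Fin 3 → Plane) (m : ℕ) (v : gasket q → ℝ) :
    Continuous (codeExt q m v) := by
  have h1 : Continuous fun p : (Fin m → Fin 3) × (ℕ → Fin 3) =>
      harm (fun i => v (vertex q (List.ofFn p.1) i)) p.2 :=
    continuous_prod_of_discrete_left.2 fun σ =>
      continuous_harm fun i => v (vertex q (List.ofFn σ) i)
  have h2 : Continuous fun ω : ℕ → Fin 3 => ((fun k : Fin m => ω k), fun n => ω (n + m)) := by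
    fun_prop
  exact Continuous.congr (h1.comp h2) fun ω => rfl

/-- The coding map is a continuous surjection from a compact space onto a Hausdorff space, hence a
quotient map, so continuity may be tested on addresses. -/
theorem continuous_harmExt {q : Fin 3 → Plane}
    (hq : ∀ k l : Fin 3, k ≠ l → dist (q k) (q l) = 1) (m : ℕ) (v : gasket q → ℝ) :
    Continuous (harmExt q m v) := by
  have hquot : IsQuotientMap (gasketPoint q) :=
    (continuous_gasketPoint q).isClosedMap.isQuotientMap (continuous_gasketPoint q)
      (gasketPoint_surjective q)
  rw [hquot.continuous_iff]
  exact (continuous_codeExt q m v).congr fun ω => (harmExt_gasketPoint hq m v ω).symm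

theorem harmExt_vertex {q : Fin 3 → Plane}
    (hq : ∀ k l : Fin 3, k ≠ l → dist (q k) (q l) = 1) {m : ℕ} (v : gasket q → ℝ)
    {w : List (Fin 3)} (hw : w.length = m) (w' : List (Fin 3)) (i : Fin 3) :
    harmExt q m v (vertex q (w ++ w') i) = harmIter w' (fun j => v (vertex q w j)) i := by
  subst hw
  rw [← gasketPoint_code, harmExt_gasketPoint hq, codeExt, ← harm_code]
  have h1 : (List.ofFn fun k : Fin w.length => code (w ++ w') i k) = w := by
    refine List.ext_getElem (by simp) fun n h1 h2 => ?_
    rw [List.getElem_ofFn, code, List.getD_append _ _ _ _ h2, List.getD_eq_getElem _ _ h2]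
  have h2 : (fun n => code (w ++ w') i (n + w.length)) = code w' i := by
    funext n
    rw [code, code, List.getD_append_right _ _ _ _ (by omega), Nat.add_sub_cancel]
  rw [h1, h2]

/-! ### Vertices and cells -/

theorem vertex_mem_V (q : Fin 3 → Plane) {n : ℕ} {w : List (Fin 3)} (hw : w.length = n)
    (i : Fin 3) : vertex q w i ∈ V q n :=
  ⟨w, hw, q i, mem_range_self i, rfl⟩

theorem exists_vertex_eq {q : Fin 3 → Plane} {n : ℕ} {x : gasket q} (hx : x ∈ V q n) :
    ∃ w i, w.length = n ∧ vertex q w i = x := by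
  obtain ⟨w, hw, _, ⟨i, rfl⟩, h⟩ := hx
  exact ⟨w, i, hw, Subtype.ext h⟩

theorem vertex_injective {q : Fin 3 → Plane} (hq : ∀ k l : Fin 3, k ≠ l → dist (q k) (q l) = 1)
    (w : List (Fin 3)) : Function.Injective (vertex q w) := fun i j h => by
  have h1 := wordMap_injective q w (congrArg Subtype.val h)
  by_contra hne
  have h2 := hq i j hne
  rw [h1, dist_self] at h2
  exact zero_ne_one h2

theorem adj_iff {q : Fin 3 → Plane} (hq : ∀ k l : Fin 3, k ≠ l → dist (q k) (q l) = 1) {n : ℕ}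
    {x y : V q n} : (G q n).Adj x y ↔
      ∃ w i j, w.length = n ∧ i ≠ j ∧ vertex q w i = x ∧ vertex q w j = y := by
  constructor
  · rintro ⟨hne, w, hw, ⟨_, ⟨i, rfl⟩, hi⟩, ⟨_, ⟨j, rfl⟩, hj⟩⟩
    refine ⟨w, i, j, hw, ?_, Subtype.ext hi, Subtype.ext hj⟩
    rintro rfl
    exact hne (Subtype.ext (Subtype.ext (hi.symm.trans hj)))
  · rintro ⟨w, i, j, hw, hij, hi, hj⟩
    refine ⟨?_, w, hw, ⟨q i, mem_range_self i, congrArg Subtype.val hi⟩,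
      ⟨q j, mem_range_self j, congrArg Subtype.val hj⟩⟩
    rintro rfl
    exact hij (vertex_injective hq w (hi.trans hj.symm))

theorem point_code_eq_of_vertex_eq {q : Fin 3 → Plane} {w w' : List (Fin 3)} {i i' : Fin 3}
    (h : vertex q w i = vertex q w' i') : point q (code w i) = point q (code w' i') := by
  rw [point_code, point_code]
  exact congrArg Subtype.val h

/-- Two different cells of the same level have at most one common vertex. -/
theorem cell_eq_of_two_vertices {q : Fin 3 → Plane}
    (hq : ∀ k l : Fin 3, k ≠ l → dist (q k) (q l) = 1) {w w' : List (Fin 3)}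
    (hw : w.length = w'.length) {i j i' j' : Fin 3} (hij : i ≠ j)
    (hi : vertex q w i = vertex q w' i') (hj : vertex q w j = vertex q w' j') : w = w' := by
  by_contra hne
  -- The addresses branch at the first letter where `w` and `w'` differ, and that letter of `w` is
  -- `i'`. The same letter must then be `j'`, so the two shared vertices coincide.
  have key : ∀ {i i'}, vertex q w i = vertex q w' i' → ∃ n < w.length,
      (∀ k < n, code w 0 k = code w' 0 k) ∧ code w 0 n ≠ code w' 0 n ∧ code w 0 n = i' := by
    intro i i' h
    obtain ⟨n, h1, h2, -, h3⟩ := exists_branch_of_point_eq hq (point_code_eq_of_vertex_eq h)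
      fun h => hne (code_injective hw h).1
    have hn : n < w.length := by
      by_contra hn
      have h4 := h3 (n + 1) n.lt_succ_self
      rw [code_of_length_le (by omega), code_of_length_le (by omega)] at h4
      rw [code_of_length_le (by omega), code_of_length_le (by omega)] at h2
      exact h2 h4.symm
    refine ⟨n, hn, fun k hk => ?_, ?_, ?_⟩
    · rw [code_eq_of_length 0 i (hk.trans hn), code_eq_of_length 0 i' (hw ▸ hk.trans hn), h1 k hk]
    · rwa [code_eq_of_length 0 i hn, code_eq_of_length 0 i' (hw ▸ hn)]
    · rw [code_eq_of_length 0 i hn, ← h3 w.length hn, code_of_length_le hw.ge]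
  obtain ⟨n, -, h1, h2, rfl⟩ := key hi
  obtain ⟨n', -, h1', h2', rfl⟩ := key hj
  have hnn : n = n' := by
    rcases lt_trichotomy n n' with h | h | h
    · exact absurd (h1' n h) h2
    · exact h
    · exact absurd (h1 n' h) h2'
  subst hnn
  exact hij (vertex_injective hq w (hi.trans hj.symm))

/-- Vertices of high level are dense: truncating an address and continuing it by 0 gives vertices
converging to the point. -/
theorem eq_of_eqOn_vertices {q : Fin 3 → Plane} {f g : gasket q → ℝ} (hf : Continuous f)
    (hg : Continuous g) {m : ℕ}
    (h : ∀ n, m ≤ n → ∀ w : List (Fin 3), w.length = n → ∀ i, f (vertex q w i) = g (vertex q w i)) :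
    f = g := by
  funext x
  obtain ⟨ω, rfl⟩ := gasketPoint_surjective q x
  have hlim : Tendsto (fun n : ℕ => gasketPoint q (code (List.ofFn fun k : Fin n => ω k) 0)) atTop
      (𝓝 (gasketPoint q ω)) := by
    refine ((continuous_gasketPoint q).tendsto ω).comp (tendsto_pi_nhds.2 fun k => ?_)
    refine tendsto_const_nhds.congr' ?_
    filter_upwards [eventually_gt_atTop k] with n hn
    rw [code, List.getD_eq_getElem _ _ (by simpa using hn), List.getElem_ofFn]
  refine tendsto_nhds_unique ((hf.tendsto _).comp hlim)
    (((hg.tendsto _).comp hlim).congr' ?_)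
  filter_upwards [eventually_ge_atTop m] with n hn
  simp only [Function.comp, gasketPoint_code]
  exact (h n hn _ (List.length_ofFn) 0).symm

/-! ### The energy as a sum over cells -/

/-- The words of length `n`. -/
def words : ℕ → Finset (List (Fin 3))
  | 0 => {[]}
  | n + 1 => (words n ×ˢ Finset.univ).image fun p => p.1 ++ [p.2]

theorem mem_words {n : ℕ} {w : List (Fin 3)} : w ∈ words n ↔ w.length = n := by
  induction n generalizing w with
  | zero => simp [words]
  | succ n ih =>
    simp only [words, Finset.mem_image, Finset.mem_product, Finset.mem_univ, and_true, ih,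
      Prod.exists]
    constructor
    · rintro ⟨v, i, hv, rfl⟩
      simp [hv]
    · intro hw
      have hne : w ≠ [] := by
        rintro rfl
        simp at hw
      exact ⟨w.dropLast, w.getLast hne, by simp [hw], List.dropLast_append_getLast hne⟩

theorem sum_words_succ (n : ℕ) (f : List (Fin 3) → ℝ) :
    ∑ w ∈ words (n + 1), f w = ∑ w ∈ words n, ∑ i, f (w ++ [i]) := by
  rw [words, Finset.sum_image, Finset.sum_product]
  rintro ⟨v, i⟩ - ⟨v', i'⟩ - h
  obtain ⟨h1, h2⟩ := List.append_inj' h rfl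
  exact Prod.ext h1 (List.singleton_inj.1 h2)

/-- The unscaled energy of the values at the vertices of one cell. -/
def cellEnergy (a : Fin 3 → ℝ) : ℝ := ∑ i, ∑ j, (a i - a j) ^ 2

/-- Completing the square in the three midpoint values `b 0 1`, `b 0 2`, `b 1 2`: the minimiser is
the harmonic rule, and the minimal value explains the renormalisation factor 3/5. -/
theorem sum_cellEnergy_eq {a : Fin 3 → ℝ} {b : Fin 3 → Fin 3 → ℝ} (hd : ∀ i, b i i = a i)
    (hs : ∀ i j, b i j = b j i) : ∑ i, cellEnergy (b i) = 3 / 5 * cellEnergy a +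
      2 * (2 * ((b 0 1 - harmStep 0 a 1) ^ 2 + (b 0 2 - harmStep 0 a 2) ^ 2 +
        (b 1 2 - harmStep 1 a 2) ^ 2) +
        ((b 0 1 - harmStep 0 a 1) - (b 0 2 - harmStep 0 a 2)) ^ 2 +
        ((b 0 1 - harmStep 0 a 1) - (b 1 2 - harmStep 1 a 2)) ^ 2 +
        ((b 0 2 - harmStep 0 a 2) - (b 1 2 - harmStep 1 a 2)) ^ 2) := by
  simp only [cellEnergy, Fin.sum_univ_three, hd, hs 1 0, hs 2 0, hs 2 1, harmStep, Fin.reduceEq,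
    Fin.isValue, if_false]
  ring

theorem cellEnergy_le {a : Fin 3 → ℝ} {b : Fin 3 → Fin 3 → ℝ} (hd : ∀ i, b i i = a i)
    (hs : ∀ i j, b i j = b j i) : 3 / 5 * cellEnergy a ≤ ∑ i, cellEnergy (b i) := by
  rw [sum_cellEnergy_eq hd hs]
  exact le_add_of_nonneg_right (by positivity)

theorem cellEnergy_eq_iff {a : Fin 3 → ℝ} {b : Fin 3 → Fin 3 → ℝ} (hd : ∀ i, b i i = a i)
    (hs : ∀ i j, b i j = b j i) :
    3 / 5 * cellEnergy a = ∑ i, cellEnergy (b i) ↔ ∀ i, b i = harmStep i a := by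
  rw [sum_cellEnergy_eq hd hs]
  constructor
  · intro h
    set x := b 0 1 - harmStep 0 a 1 with hx
    set y := b 0 2 - harmStep 0 a 2 with hy
    set z := b 1 2 - harmStep 1 a 2 with hz
    have hx0 : x = 0 := pow_eq_zero_iff two_ne_zero |>.1
      (by nlinarith [sq_nonneg x, sq_nonneg y, sq_nonneg z, sq_nonneg (x - y), sq_nonneg (x - z),
        sq_nonneg (y - z)])
    have hy0 : y = 0 := pow_eq_zero_iff two_ne_zero |>.1
      (by nlinarith [sq_nonneg x, sq_nonneg y, sq_nonneg z, sq_nonneg (x - y), sq_nonneg (x - z),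
        sq_nonneg (y - z)])
    have hz0 : z = 0 := pow_eq_zero_iff two_ne_zero |>.1
      (by nlinarith [sq_nonneg x, sq_nonneg y, sq_nonneg z, sq_nonneg (x - y), sq_nonneg (x - z),
        sq_nonneg (y - z)])
    have h01 : b 0 1 = harmStep 0 a 1 := sub_eq_zero.1 hx0
    have h02 : b 0 2 = harmStep 0 a 2 := sub_eq_zero.1 hy0
    have h12 : b 1 2 = harmStep 1 a 2 := sub_eq_zero.1 hz0
    have hlt : ∀ i j : Fin 3, i < j → b i j = harmStep i a j := fun i j hij => by
      obtain ⟨rfl, rfl⟩ | ⟨rfl, rfl⟩ | ⟨rfl, rfl⟩ :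
          (i = 0 ∧ j = 1) ∨ (i = 0 ∧ j = 2) ∨ (i = 1 ∧ j = 2) := by revert i j; decide
      exacts [h01, h02, h12]
    intro i
    funext j
    rcases lt_trichotomy i j with hij | rfl | hij
    · exact hlt i j hij
    · rw [hd, harmStep_self]
    · rw [hs, harmStep_comm, hlt j i hij]
  · intro h
    simp [h]

/-- Each edge belongs to exactly one cell by `cell_eq_of_two_vertices`, so oriented edges correspond
bijectively to a cell with two distinct corners. -/
theorem graphEnergy_eq {q : Fin 3 → Plane} (hq : ∀ k l : Fin 3, k ≠ l → dist (q k) (q l) = 1)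
    (n : ℕ) (f : gasket q → ℝ) : graphEnergy q n f =
      ((3 / 5 : ℝ) ^ n)⁻¹ * ∑ w ∈ words n, cellEnergy fun i => f (vertex q w i) := by
  classical
  rw [graphEnergy]
  congr 1
  have hl : ∑ p : V q n, ∑ p' : V q n with (G q n).Adj p p', (f p - f p') ^ 2 =
      ∑ x : V q n × V q n with (G q n).Adj x.1 x.2, (f x.1 - f x.2) ^ 2 := by
    rw [Finset.sum_filter, Fintype.sum_prod_type]
    simp_rw [Finset.sum_filter]
  have hr : ∑ w ∈ words n, cellEnergy (fun i => f (vertex q w i)) =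
      ∑ t ∈ words n ×ˢ (Finset.univ : Finset (Fin 3 × Fin 3)) with t.2.1 ≠ t.2.2,
        (f (vertex q t.1 t.2.1) - f (vertex q t.1 t.2.2)) ^ 2 := by
    rw [Finset.sum_filter_of_ne, Finset.sum_product]
    · simp_rw [Fintype.sum_prod_type, cellEnergy]
    · rintro t - ht h
      rw [h, sub_self] at ht
      simp at ht
  have hlen : ∀ {t : List (Fin 3) × Fin 3 × Fin 3},
      t ∈ (words n ×ˢ (Finset.univ : Finset (Fin 3 × Fin 3))).filter (fun t => t.2.1 ≠ t.2.2) →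
        t.1.length = n := fun ht =>
    mem_words.1 (Finset.mem_product.1 (Finset.mem_filter.1 ht).1).1
  convert hl.trans (Eq.trans ?_ hr.symm)
  symm
  refine Finset.sum_bij (fun t ht =>
    (⟨vertex q t.1 t.2.1, vertex_mem_V q (hlen ht) _⟩,
      ⟨vertex q t.1 t.2.2, vertex_mem_V q (hlen ht) _⟩)) ?_ ?_ ?_ ?_
  · rintro ⟨w, i, j⟩ ht
    refine Finset.mem_filter.2 ⟨Finset.mem_univ _, ?_⟩
    exact (adj_iff hq).2 ⟨w, i, j, hlen ht, (Finset.mem_filter.1 ht).2, rfl, rfl⟩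
  · rintro ⟨w, i, j⟩ ht ⟨w', i', j'⟩ ht' h
    have h1 : vertex q w i = vertex q w' i' := congrArg Subtype.val (Prod.ext_iff.1 h).1
    have h2 : vertex q w j = vertex q w' j' := congrArg Subtype.val (Prod.ext_iff.1 h).2
    have hw := cell_eq_of_two_vertices hq ((hlen ht).trans (hlen ht').symm)
      (Finset.mem_filter.1 ht).2 h1 h2
    subst hw
    rw [vertex_injective hq w h1, vertex_injective hq w h2]
  · rintro ⟨x, y⟩ h
    obtain ⟨w, i, j, hw, hij, hi, hj⟩ := (adj_iff hq).1 (Finset.mem_filter.1 h).2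
    exact ⟨(w, i, j), Finset.mem_filter.2
      ⟨Finset.mem_product.2 ⟨mem_words.2 hw, Finset.mem_univ _⟩, hij⟩,
      Prod.ext (Subtype.ext hi) (Subtype.ext hj)⟩
  · rintro ⟨w, i, j⟩ ht
    rfl

theorem vertex_append_self (q : Fin 3 → Plane) (w : List (Fin 3)) (i : Fin 3) :
    vertex q (w ++ [i]) i = vertex q w i := by
  refine Subtype.ext ?_
  simp [vertex, wordMap_append, wordMap, F]

/-- Both are the midpoint of `F_w(q_i)` and `F_w(q_j)`. -/
theorem vertex_append_comm (q : Fin 3 → Plane) (w : List (Fin 3)) (i j : Fin 3) :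
    vertex q (w ++ [i]) j = vertex q (w ++ [j]) i := by
  refine Subtype.ext ?_
  simp only [vertex, wordMap_append]
  congr 1
  simp only [wordMap, F, Function.comp, id]
  module

theorem graphEnergy_succ_eq {q : Fin 3 → Plane}
    (hq : ∀ k l : Fin 3, k ≠ l → dist (q k) (q l) = 1) (n : ℕ) (f : gasket q → ℝ) :
    graphEnergy q n f = ((3 / 5 : ℝ) ^ (n + 1))⁻¹ *
      ∑ w ∈ words n, 3 / 5 * cellEnergy fun i => f (vertex q w i) := by
  rw [graphEnergy_eq hq, ← Finset.mul_sum, pow_succ]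
  field_simp

theorem graphEnergy_le_succ {q : Fin 3 → Plane}
    (hq : ∀ k l : Fin 3, k ≠ l → dist (q k) (q l) = 1) (n : ℕ) (f : gasket q → ℝ) :
    graphEnergy q n f ≤ graphEnergy q (n + 1) f := by
  rw [graphEnergy_succ_eq hq, graphEnergy_eq hq, sum_words_succ]
  refine mul_le_mul_of_nonneg_left (Finset.sum_le_sum fun w _ => ?_) (by positivity)
  exact cellEnergy_le (fun i => congrArg f (vertex_append_self q w i))
    fun i j => congrArg f (vertex_append_comm q w i j)

theorem graphEnergy_mono {q : Fin 3 → Plane}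
    (hq : ∀ k l : Fin 3, k ≠ l → dist (q k) (q l) = 1) (f : gasket q → ℝ) :
    Monotone fun n => graphEnergy q n f :=
  monotone_nat_of_le_succ fun n => graphEnergy_le_succ hq n f

/-- `f` satisfies the harmonic extension rule when passing from level `n` to level `n + 1`. -/
def IsHarmonicStep (q : Fin 3 → Plane) (n : ℕ) (f : gasket q → ℝ) : Prop :=
  ∀ w : List (Fin 3), w.length = n → ∀ i,
    (fun j => f (vertex q (w ++ [i]) j)) = harmStep i fun k => f (vertex q w k)

theorem graphEnergy_succ_eq_iff {q : Fin 3 → Plane}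
    (hq : ∀ k l : Fin 3, k ≠ l → dist (q k) (q l) = 1) (n : ℕ) (f : gasket q → ℝ) :
    graphEnergy q n f = graphEnergy q (n + 1) f ↔ IsHarmonicStep q n f := by
  have hd : ∀ w i, f (vertex q (w ++ [i]) i) = f (vertex q w i) := fun w i =>
    congrArg f (vertex_append_self q w i)
  have hs : ∀ w i j, f (vertex q (w ++ [i]) j) = f (vertex q (w ++ [j]) i) := fun w i j =>
    congrArg f (vertex_append_comm q w i j)
  rw [graphEnergy_succ_eq hq, graphEnergy_eq hq, sum_words_succ, mul_right_inj' (by positivity),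
    Finset.sum_eq_sum_iff_of_le fun w _ => cellEnergy_le (hd w) (hs w)]
  refine forall_congr' fun w => ?_
  rw [mem_words]
  exact imp_congr_right fun _ => cellEnergy_eq_iff (hd w) (hs w)

/-! ### Harmonic splines -/

theorem harmExt_eq_of_mem_V {q : Fin 3 → Plane}
    (hq : ∀ k l : Fin 3, k ≠ l → dist (q k) (q l) = 1) {m : ℕ} (v : gasket q → ℝ) {x : gasket q}
    (hx : x ∈ V q m) : harmExt q m v x = v x := by
  obtain ⟨w, i, hw, rfl⟩ := exists_vertex_eq hx
  have := harmExt_vertex hq v hw [] i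
  rwa [List.append_nil] at this

theorem harmExt_congr {q : Fin 3 → Plane} {m : ℕ} {v v' : gasket q → ℝ}
    (h : ∀ x ∈ V q m, v x = v' x) : harmExt q m v = harmExt q m v' := by
  funext x
  simp only [harmExt, codeExt]
  congr 1
  funext i
  exact h _ (vertex_mem_V q List.length_ofFn i)

theorem isHarmonicStep_harmExt {q : Fin 3 → Plane}
    (hq : ∀ k l : Fin 3, k ≠ l → dist (q k) (q l) = 1) {m n : ℕ} (hmn : m ≤ n)
    (v : gasket q → ℝ) : IsHarmonicStep q n (harmExt q m v) := by
  intro w hw i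
  have hlen : (w.take m).length = m := by simp [hw, hmn]
  rw [← List.take_append_drop m w, List.append_assoc]
  simp_rw [harmExt_vertex hq v hlen]
  rw [harmIter_append]
  rfl

theorem graphEnergy_harmExt {q : Fin 3 → Plane}
    (hq : ∀ k l : Fin 3, k ≠ l → dist (q k) (q l) = 1) {m n : ℕ} (hmn : m ≤ n)
    (v : gasket q → ℝ) : graphEnergy q n (harmExt q m v) = graphEnergy q m v := by
  induction n, hmn using Nat.le_induction with
  | base =>
    rw [graphEnergy, graphEnergy]
    simp_rw [fun p : V q m => harmExt_eq_of_mem_V hq v p.2]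
  | succ n hmn ih =>
    rw [← ih]
    exact ((graphEnergy_succ_eq_iff hq n _).2 (isHarmonicStep_harmExt hq hmn v)).symm

theorem graphEnergy_congr {q : Fin 3 → Plane} {m : ℕ} {f g : gasket q → ℝ}
    (h : ∀ x ∈ V q m, f x = g x) : graphEnergy q m f = graphEnergy q m g := by
  rw [graphEnergy, graphEnergy]
  simp_rw [fun p : V q m => h p p.2]

/-- The piecewise harmonic extension as a continuous function. -/
noncomputable def harmExtC {q : Fin 3 → Plane}
    (hq : ∀ k l : Fin 3, k ≠ l → dist (q k) (q l) = 1) (m : ℕ) (v : gasket q → ℝ) :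
    C(gasket q, ℝ) :=
  ⟨harmExt q m v, continuous_harmExt hq m v⟩

/-- Extension does not raise the energy, while any competitor `g` has `E_m(v) = E_m(g) ≤ E_n(g)`. -/
theorem isPiecewiseHarmonic_harmExtC {q : Fin 3 → Plane}
    (hq : ∀ k l : Fin 3, k ≠ l → dist (q k) (q l) = 1) (m : ℕ) (v : gasket q → ℝ) :
    IsPiecewiseHarmonic q m (harmExtC hq m v) := by
  intro n hn g hg
  change graphEnergy q n (harmExt q m v) ≤ _
  rw [graphEnergy_harmExt hq (by omega)]
  have h1 : graphEnergy q m v = graphEnergy q m g :=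
    graphEnergy_congr fun x hx => ((hg x hx).trans (harmExt_eq_of_mem_V hq v hx)).symm
  rw [h1]
  exact graphEnergy_mono hq g (by omega)

/-- Comparison with the extension `h` of `f` from level `m` gives `E_{n+1}(f) ≤ E_{n+1}(h) = E_m(f)
≤ E_n(f)`. Equality of consecutive energies then forces the rule in every cell. -/
theorem IsPiecewiseHarmonic.isHarmonicStep {q : Fin 3 → Plane}
    (hq : ∀ k l : Fin 3, k ≠ l → dist (q k) (q l) = 1) {m n : ℕ} {f : C(gasket q, ℝ)}
    (hf : IsPiecewiseHarmonic q m f) (hmn : m ≤ n) : IsHarmonicStep q n f := by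
  rw [← graphEnergy_succ_eq_iff hq]
  refine le_antisymm (graphEnergy_le_succ hq n f) ?_
  refine (hf (n + 1) (by omega) (harmExt q m f) fun x hx => harmExt_eq_of_mem_V hq f hx).trans ?_
  rw [graphEnergy_harmExt hq (by omega)]
  exact graphEnergy_mono hq f hmn

theorem IsPiecewiseHarmonic.eq_harmExt {q : Fin 3 → Plane}
    (hq : ∀ k l : Fin 3, k ≠ l → dist (q k) (q l) = 1) {m : ℕ} {f : C(gasket q, ℝ)}
    (hf : IsPiecewiseHarmonic q m f) : (f : gasket q → ℝ) = harmExt q m f := by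
  refine eq_of_eqOn_vertices f.continuous (continuous_harmExt hq m f) (m := m) fun n hn => ?_
  induction n, hn using Nat.le_induction with
  | base => exact fun w hw i => (harmExt_eq_of_mem_V hq f (vertex_mem_V q hw i)).symm
  | succ n hn ih =>
    intro w hw i
    obtain ⟨v, l, hv, rfl⟩ : ∃ v l, v.length = n ∧ w = v ++ [l] := by
      have h1 := mem_words.2 hw
      simp only [words, Finset.mem_image, Finset.mem_product, Prod.exists, mem_words] at h1
      obtain ⟨v, l, hv, rfl⟩ := h1
      exact ⟨v, l, hv.1, rfl⟩
    rw [congrFun (hf.isHarmonicStep hq hn v hv l) i,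
      congrFun (isHarmonicStep_harmExt hq hn f v hv l) i]
    congr 1
    exact funext fun k => ih v hv k

open Classical in
/-- The values of the spline at `p` on the vertices. -/
noncomputable def delta {q : Fin 3 → Plane} {m : ℕ} (p : V q m) (x : gasket q) : ℝ :=
  if x = p then 1 else 0

theorem isHarmonicSpline_iff {q : Fin 3 → Plane}
    (hq : ∀ k l : Fin 3, k ≠ l → dist (q k) (q l) = 1) {m : ℕ} (p : V q m)
    (f : C(gasket q, ℝ)) : IsHarmonicSpline q m p f ↔ f = harmExtC hq m (delta p) := by
  constructor
  · rintro ⟨hf, hp⟩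
    refine ContinuousMap.coe_injective ?_
    rw [hf.eq_harmExt hq]
    refine harmExt_congr fun x hx => ?_
    rw [hp ⟨x, hx⟩, delta]
    simp only [Subtype.ext_iff]
  · rintro rfl
    refine ⟨isPiecewiseHarmonic_harmExtC hq m _, fun p' => ?_⟩
    change harmExt q m (delta p) p' = _
    rw [harmExt_eq_of_mem_V hq _ p'.2, delta]
    simp only [Subtype.ext_iff]

theorem existsUnique_isHarmonicSpline {q : Fin 3 → Plane}
    (hq : ∀ k l : Fin 3, k ≠ l → dist (q k) (q l) = 1) {m : ℕ} (p : V q m) :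
    ∃! ψ : C(gasket q, ℝ), IsHarmonicSpline q m p ψ := by
  simp_rw [isHarmonicSpline_iff hq]
  exact existsUnique_eq

theorem isHarmonicSpline_psi {q : Fin 3 → Plane}
    (hq : ∀ k l : Fin 3, k ≠ l → dist (q k) (q l) = 1) {m : ℕ} (p : V q m) :
    IsHarmonicSpline q m p (psi q m p) :=
  Classical.epsilon_spec (existsUnique_isHarmonicSpline hq p).exists

theorem psi_gasketPoint {q : Fin 3 → Plane}
    (hq : ∀ k l : Fin 3, k ≠ l → dist (q k) (q l) = 1) {m : ℕ} (p : V q m) (ω : ℕ → Fin 3) :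
    psi q m p (gasketPoint q ω) =
      harm (fun i => delta p (vertex q (List.ofFn fun k : Fin m => ω k) i))
        fun n => ω (n + m) := by
  rw [(isHarmonicSpline_iff hq p _).1 (isHarmonicSpline_psi hq p)]
  exact harmExt_gasketPoint hq m _ ω

theorem psi_nonneg {q : Fin 3 → Plane} (hq : ∀ k l : Fin 3, k ≠ l → dist (q k) (q l) = 1)
    {m : ℕ} (p : V q m) (x : gasket q) : 0 ≤ psi q m p x := by
  obtain ⟨ω, rfl⟩ := gasketPoint_surjective q x
  rw [psi_gasketPoint hq]
  refine harm_nonneg (fun i => ?_) _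
  rw [delta]
  split_ifs <;> norm_num

theorem psi_self {q : Fin 3 → Plane} (hq : ∀ k l : Fin 3, k ≠ l → dist (q k) (q l) = 1)
    {m : ℕ} (p : V q m) : psi q m p p = 1 := by
  rw [(isHarmonicSpline_psi hq p).2 p, if_pos rfl]

/-- On each cell of level `m` the corner values of the splines add up to 1, and the extension is
linear and preserves constants. -/
theorem sum_psi {q : Fin 3 → Plane} (hq : ∀ k l : Fin 3, k ≠ l → dist (q k) (q l) = 1)
    (m : ℕ) (x : gasket q) : ∑ p : V q m, psi q m p x = 1 := by
  obtain ⟨ω, rfl⟩ := gasketPoint_surjective q x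
  simp_rw [psi_gasketPoint hq]
  rw [← harm_sum, ← harm_one fun n => ω (n + m)]
  congr 1
  funext i
  rw [Finset.sum_apply, Finset.sum_eq_single ⟨_, vertex_mem_V q List.length_ofFn i⟩]
  · exact if_pos rfl
  · rintro p - hp
    exact if_neg fun h => hp (Subtype.ext h.symm)
  · exact fun h => absurd (Finset.mem_univ _) h

/-! ### Vertex degrees -/

open Classical in
/-- The addresses `(w, i)` with `|w| = m` of the vertex `p`. -/
noncomputable def addresses (q : Fin 3 → Plane) (m : ℕ) (p : gasket q) :
    Finset (List (Fin 3) × Fin 3) :=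
  (words m ×ˢ Finset.univ).filter fun t => vertex q t.1 t.2 = p

theorem mem_addresses {q : Fin 3 → Plane} {m : ℕ} {p : gasket q} {t : List (Fin 3) × Fin 3} :
    t ∈ addresses q m p ↔ t.1.length = m ∧ vertex q t.1 t.2 = p := by
  simp [addresses, mem_words]

theorem code_ne_of_mem_addresses {q : Fin 3 → Plane} {m : ℕ} {p : gasket q}
    {s t : List (Fin 3) × Fin 3} (hs : s ∈ addresses q m p) (ht : t ∈ addresses q m p)
    (hne : s ≠ t) : code s.1 s.2 ≠ code t.1 t.2 := fun h =>
  hne (Prod.ext_iff.2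
    (code_injective ((mem_addresses.1 hs).1.trans (mem_addresses.1 ht).1.symm) h))

theorem card_addresses_le_two {q : Fin 3 → Plane}
    (hq : ∀ k l : Fin 3, k ≠ l → dist (q k) (q l) = 1) (m : ℕ) (p : gasket q) :
    (addresses q m p).card ≤ 2 := by
  by_contra! h
  obtain ⟨a, b, c, ha, hb, hc, hab, hac, hbc⟩ := Finset.two_lt_card_iff.1 h
  have hp : ∀ {s t}, s ∈ addresses q m p → t ∈ addresses q m p →
      point q (code s.1 s.2) = point q (code t.1 t.2) := fun hs ht =>
    point_code_eq_of_vertex_eq ((mem_addresses.1 hs).2.trans (mem_addresses.1 ht).2.symm)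
  exact code_ne_of_mem_addresses hb hc hbc (point_code_unique hq (hp ha hb) (hp ha hc)
    (code_ne_of_mem_addresses ha hb hab) (code_ne_of_mem_addresses ha hc hac))

theorem card_addresses_le_one {q : Fin 3 → Plane}
    (hq : ∀ k l : Fin 3, k ≠ l → dist (q k) (q l) = 1) (m : ℕ) {p : gasket q} (hp : p ∈ V q 0) :
    (addresses q m p).card ≤ 1 := by
  rw [Finset.card_le_one]
  intro s hs t ht
  obtain ⟨w, i, hw, rfl⟩ := exists_vertex_eq hp
  obtain rfl := List.length_eq_zero_iff.1 hw
  have h : ∀ {t}, t ∈ addresses q m (vertex q [] i) → code t.1 t.2 = fun _ => i := fun ht =>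
    eq_const_of_point_eq_vertex hq <|
      (point_code_eq_of_vertex_eq (mem_addresses.1 ht).2).trans (point_code q [] i)
  by_contra hne
  exact code_ne_of_mem_addresses hs ht hne ((h hs).trans (h ht).symm)

-- A neighbour of `p` is one of the two other corners of a cell of level `m` having `p` as a corner,
-- and such cells are counted by the addresses of `p`.
open Classical in
theorem degree_le {q : Fin 3 → Plane} (hq : ∀ k l : Fin 3, k ≠ l → dist (q k) (q l) = 1) {m : ℕ}
    (p : V q m) : (G q m).degree p ≤ (addresses q m p).card * 2 := by
  rw [← SimpleGraph.card_neighborFinset_eq_degree,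
    ← Finset.card_image_of_injective _ (Subtype.val_injective (p := fun x => x ∈ V q m))]
  have hsub : ((G q m).neighborFinset p).image Subtype.val ⊆ (addresses q m p).biUnion fun t =>
      (Finset.univ.erase t.2).image (vertex q t.1) := by
    intro x hx
    obtain ⟨y, hy, rfl⟩ := Finset.mem_image.1 hx
    obtain ⟨w, i, j, hw, hij, hi, hj⟩ := (adj_iff hq).1 ((SimpleGraph.mem_neighborFinset _ _ _).1 hy)
    exact Finset.mem_biUnion.2 ⟨(w, i), mem_addresses.2 ⟨hw, hi⟩,
      Finset.mem_image.2 ⟨j, Finset.mem_erase.2 ⟨hij.symm, Finset.mem_univ _⟩, hj⟩⟩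
  refine (Finset.card_le_card hsub).trans (Finset.card_biUnion_le_card_mul _ _ _ fun t _ => ?_)
  refine Finset.card_image_le.trans ?_
  rw [Finset.card_erase_of_mem (Finset.mem_univ _)]
  rfl

theorem vertexWeight_pos (q : Fin 3 → Plane) (p : gasket q) : 0 < vertexWeight q p := by
  rw [vertexWeight]
  split_ifs <;> norm_num

-- Here the weights 1/2 and 1/4 enter: a point of `V_0` lies in at most one cell and any other
-- vertex in at most two, so the degrees are at most 2 and 4.
open Classical in
theorem degree_mul_vertexWeight_le {q : Fin 3 → Plane}
    (hq : ∀ k l : Fin 3, k ≠ l → dist (q k) (q l) = 1) {m : ℕ} (p : V q m) :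
    (G q m).degree p * vertexWeight q p ≤ 1 := by
  have h := degree_le hq p
  rw [vertexWeight]
  split_ifs with hp
  · have h1 := card_addresses_le_one hq m hp
    have h2 : ((G q m).degree p : ℝ) ≤ 2 := by exact_mod_cast (by omega : (G q m).degree p ≤ 2)
    linarith
  · have h1 := card_addresses_le_two hq m (p : gasket q)
    have h2 : ((G q m).degree p : ℝ) ≤ 4 := by exact_mod_cast (by omega : (G q m).degree p ≤ 4)
    linarith

/-! ### The functions attached to the edges -/

theorem Orientation.i_ne_j {q : Fin 3 → Plane} {m : ℕ} (o : Orientation q m) (e : E q m) :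
    o.i e ≠ o.j e := by
  have h : s(o.i e, o.j e) ∈ (G q m).edgeSet := by
    rw [o.ends e]
    exact e.2
  exact ((G q m).mem_edgeSet.1 h).ne

-- Double counting of incident pairs of a vertex and an edge.
open Classical in
theorem sum_edge_ends_le {q : Fin 3 → Plane} {m : ℕ} (o : Orientation q m) {g : V q m → ℝ}
    (hg : ∀ p, 0 ≤ g p) :
    ∑ e : E q m, (g (o.i e) + g (o.j e)) ≤ ∑ p : V q m, (G q m).degree p * g p := by
  have h1 : ∀ e : E q m, g (o.i e) + g (o.j e) =
      ∑ p : V q m, if p ∈ (e : Sym2 (V q m)) then g p else 0 := fun e => by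
    rw [← Finset.sum_filter, ← Finset.sum_pair (o.i_ne_j e)]
    refine Finset.sum_congr (Finset.ext fun p => ?_) fun _ _ => rfl
    rw [← o.ends e]
    simp
  simp_rw [h1]
  rw [Finset.sum_comm]
  refine Finset.sum_le_sum fun p _ => ?_
  rw [← Finset.sum_filter, Finset.sum_const, nsmul_eq_mul]
  refine mul_le_mul_of_nonneg_right (Nat.cast_le.2 ?_) (hg p)
  rw [← SimpleGraph.card_incidenceFinset_eq_degree]
  refine Finset.card_le_card_of_injOn Subtype.val (fun e he => ?_) Subtype.val_injective.injOn
  rw [SimpleGraph.coe_incidenceFinset]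
  exact ⟨e.2, (Finset.mem_filter.1 he).2⟩

theorem psiEdge_apply (q : Fin 3 → Plane) {m : ℕ} (o : Orientation q m) (e : E q m)
    (x : gasket q) : psiEdge q m o e x = vertexWeight q (o.i e) * psi q m (o.i e) x +
      vertexWeight q (o.j e) * psi q m (o.j e) x :=
  rfl

theorem psiEdge_nonneg {q : Fin 3 → Plane} (hq : ∀ k l : Fin 3, k ≠ l → dist (q k) (q l) = 1)
    {m : ℕ} (o : Orientation q m) (e : E q m) (x : gasket q) : 0 ≤ psiEdge q m o e x := by
  rw [psiEdge_apply]
  exact add_nonneg (mul_nonneg (vertexWeight_pos _ _).le (psi_nonneg hq _ _))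
    (mul_nonneg (vertexWeight_pos _ _).le (psi_nonneg hq _ _))

theorem sum_psiEdge_le_one {q : Fin 3 → Plane}
    (hq : ∀ k l : Fin 3, k ≠ l → dist (q k) (q l) = 1) {m : ℕ} (o : Orientation q m)
    (x : gasket q) : ∑ e : E q m, psiEdge q m o e x ≤ 1 := by
  classical
  simp_rw [psiEdge_apply]
  refine (sum_edge_ends_le o (g := fun p => vertexWeight q p * psi q m p x) fun p =>
    mul_nonneg (vertexWeight_pos _ _).le (psi_nonneg hq _ _)).trans ?_
  rw [← sum_psi hq m x]
  refine Finset.sum_le_sum fun p _ => ?_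
  rw [← mul_assoc]
  exact mul_le_of_le_one_left (psi_nonneg hq _ _) (degree_mul_vertexWeight_le hq p)

/-- The integrand is continuous and nonnegative, and positive at `i(e)`, where `ψ_{i(e)} = 1`; full
support of `μ` does the rest. -/
theorem integral_psiEdge_pos {q : Fin 3 → Plane}
    (hq : ∀ k l : Fin 3, k ≠ l → dist (q k) (q l) = 1) (μ : Measure (gasket q))
    [IsFiniteMeasure μ] [μ.IsOpenPosMeasure] {m : ℕ} (o : Orientation q m) (e : E q m) :
    0 < ∫ x, psiEdge q m o e x ∂μ := by
  refine (psiEdge q m o e).continuous.integral_pos_of_hasCompactSupport_nonneg_nonzero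
    (HasCompactSupport.of_compactSpace _) (psiEdge_nonneg hq o e) (x := (o.i e : gasket q)) ?_
  rw [psiEdge_apply, psi_self hq]
  have h1 := vertexWeight_pos q (o.i e)
  have h2 := mul_nonneg (vertexWeight_pos q (o.j e)).le (psi_nonneg hq (o.j e) (o.i e))
  linarith

/-! ### The measure on the metric graph -/

theorem measurableEmbedding_sigmaMk {ι : Type*} {β : ι → Type*} [∀ i, MeasurableSpace (β i)]
    (i : ι) : MeasurableEmbedding (Sigma.mk i : β i → Sigma β) := by
  have hiff : ∀ {s : Set (Sigma β)}, MeasurableSet s ↔ ∀ j, MeasurableSet (Sigma.mk j ⁻¹' s) := by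
    intro s
    exact MeasurableSpace.measurableSet_iInf
  refine ⟨sigma_mk_injective, fun s hs => hiff.1 hs i, fun s hs => hiff.2 fun j => ?_⟩
  by_cases hij : i = j
  · subst hij
    rwa [preimage_image_eq _ sigma_mk_injective]
  · convert MeasurableSet.empty
    ext x
    simp only [mem_preimage, mem_image, mem_empty_iff_false, iff_false]
    rintro ⟨y, -, h⟩
    exact hij (congrArg Sigma.fst h)

theorem measurableEmbedding_edgePoint (q : Fin 3 → Plane) (m : ℕ) (e : E q m) :
    MeasurableEmbedding (edgePoint q m e) :=
  MeasurableEmbedding.comp (g := Sum.inr)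
    ⟨Sum.inr_injective, measurable_inr, fun _ hs => hs.inr_image⟩ (measurableEmbedding_sigmaMk e)

theorem measurableSet_range_edgePoint (q : Fin 3 → Plane) (m : ℕ) (e : E q m) :
    MeasurableSet (range (edgePoint q m e)) :=
  (measurableEmbedding_edgePoint q m e).measurableSet_range

theorem edgePoint_eq_iff {q : Fin 3 → Plane} {m : ℕ} {e e' : E q m} {s t : EdgeInterval m} :
    edgePoint q m e s = edgePoint q m e' t ↔ e = e' ∧ s = t := by
  simp [edgePoint]

theorem edgePoint_preimage_range_of_ne {q : Fin 3 → Plane} {m : ℕ} {e e' : E q m} (h : e ≠ e') :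
    edgePoint q m e' ⁻¹' range (edgePoint q m e) = ∅ := by
  ext t
  simp only [mem_preimage, mem_range, mem_empty_iff_false, iff_false]
  rintro ⟨s, hs⟩
  exact h (edgePoint_eq_iff.1 hs).1

theorem range_edgePoint_inter_of_ne {q : Fin 3 → Plane} {m : ℕ} {e e' : E q m} (h : e ≠ e') :
    range (edgePoint q m e) ∩ range (edgePoint q m e') = ∅ := by
  rw [inter_comm, ← image_preimage_eq_range_inter, edgePoint_preimage_range_of_ne h, image_empty]

theorem edgeLebesgue_univ (m : ℕ) : edgeLebesgue m univ = ENNReal.ofReal ((2 : ℝ) ^ m)⁻¹ := by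
  rw [edgeLebesgue, (MeasurableEmbedding.subtype_coe measurableSet_Ioo).comap_apply, image_univ,
    Subtype.range_coe, Real.volume_Ioo, sub_zero]

/-- The open edges are disjoint, so only the summand of `e` survives. -/
theorem restrict_graphMeasure (q : Fin 3 → Plane) (m : ℕ) (o : Orientation q m)
    (μ : Measure (gasket q)) (e : E q m) :
    (graphMeasure q m o μ).restrict (range (edgePoint q m e)) =
      ENNReal.ofReal (edgeConst q m o μ e) •
        Measure.map (edgePoint q m e) (edgeLebesgue m) := by
  rw [graphMeasure, ← Measure.restrictₗ_apply, map_sum, Finset.sum_eq_single e]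
  · rw [Measure.restrictₗ_apply, Measure.restrict_smul,
      (measurableEmbedding_edgePoint q m e).restrict_map, preimage_range, Measure.restrict_univ]
  · intro e' _ he
    rw [Measure.restrictₗ_apply, Measure.restrict_smul,
      (measurableEmbedding_edgePoint q m e').restrict_map,
      edgePoint_preimage_range_of_ne (Ne.symm he), Measure.restrict_empty, Measure.map_zero,
      smul_zero]
  · exact fun h => absurd (Finset.mem_univ e) h

theorem graphMeasure_range_edgePoint (q : Fin 3 → Plane) (m : ℕ) (o : Orientation q m)
    (μ : Measure (gasket q)) (e : E q m) : graphMeasure q m o μ (range (edgePoint q m e)) =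
      ENNReal.ofReal (∫ x, psiEdge q m o e x ∂μ) := by
  rw [← Measure.restrict_apply_univ, restrict_graphMeasure, Measure.smul_apply,
    (measurableEmbedding_edgePoint q m e).map_apply, preimage_univ, edgeLebesgue_univ, smul_eq_mul,
    ← ENNReal.ofReal_mul' (by positivity), edgeConst]
  congr 1
  field_simp

theorem graphMeasure_range_edgePoint_ne_top (q : Fin 3 → Plane) (m : ℕ) (o : Orientation q m)
    (μ : Measure (gasket q)) (e : E q m) : graphMeasure q m o μ (range (edgePoint q m e)) ≠ ∞ := by
  rw [graphMeasure_range_edgePoint]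
  exact ENNReal.ofReal_ne_top

theorem setIntegral_range_edgePoint {q : Fin 3 → Plane} {m : ℕ} {o : Orientation q m}
    {μ : Measure (gasket q)} {e : E q m} (hpos : 0 < ∫ x, psiEdge q m o e x ∂μ)
    (f : X q m → ℝ) :
    ∫ t in range (edgePoint q m e), f t ∂graphMeasure q m o μ =
      (∫ x, psiEdge q m o e x ∂μ) * edgeAverage q m f e := by
  rw [restrict_graphMeasure, integral_smul_measure,
    (measurableEmbedding_edgePoint q m e).integral_map, edgeConst,
    ENNReal.toReal_ofReal (by positivity), edgeAverage, smul_eq_mul]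
  ring

/-! ### The identification operator and its adjoint -/

/-- The indicator of the edge `e`, divided by the integral of `ψ_e`. -/
noncomputable def edgeIndicator (q : Fin 3 → Plane) (m : ℕ) (o : Orientation q m)
    (μ : Measure (gasket q)) (e : E q m) : Lp ℝ 2 (graphMeasure q m o μ) :=
  indicatorConstLp 2 (measurableSet_range_edgePoint q m e)
    (graphMeasure_range_edgePoint_ne_top q m o μ e)
    (∫ x, psiEdge q m o e x ∂μ)⁻¹

/-- The normalisation of `edgeIndicator` is by the mass of the edge, so pairing with it takes the
mean. This exhibits the edge mean as a bounded functional on classes. -/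
theorem inner_edgeIndicator_toLp {q : Fin 3 → Plane} {m : ℕ} {o : Orientation q m}
    {μ : Measure (gasket q)} {e : E q m} (hpos : 0 < ∫ x, psiEdge q m o e x ∂μ)
    {f : X q m → ℝ} (hf : MemLp f 2 (graphMeasure q m o μ)) :
    inner ℝ (edgeIndicator q m o μ e) (hf.toLp f) = edgeAverage q m f e := by
  rw [edgeIndicator, L2.inner_indicatorConstLp_eq_inner_setIntegral,
    setIntegral_congr_ae (g := f) (measurableSet_range_edgePoint q m e)
      (hf.coeFn_toLp.mono fun t ht _ => ht), setIntegral_range_edgePoint hpos,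
    RCLike.inner_apply, conj_trivial]
  field_simp

theorem inner_edgeIndicator_edgeIndicator {q : Fin 3 → Plane} {m : ℕ} {o : Orientation q m}
    {μ : Measure (gasket q)} (hpos : ∀ e, 0 < ∫ x, psiEdge q m o e x ∂μ) (e : E q m) :
    inner ℝ (edgeIndicator q m o μ e) (edgeIndicator q m o μ e) =
      (∫ x, psiEdge q m o e x ∂μ)⁻¹ := by
  have := (hpos e).ne'
  have := graphMeasure_range_edgePoint_ne_top q m o μ e
  rw [edgeIndicator, L2.inner_indicatorConstLp_indicatorConstLp, inter_self, measureReal_def,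
    graphMeasure_range_edgePoint, ENNReal.toReal_ofReal (hpos e).le, smul_eq_mul]
  rw [RCLike.inner_apply, conj_trivial]
  field_simp

theorem inner_edgeIndicator_of_ne {q : Fin 3 → Plane} {m : ℕ} (o : Orientation q m)
    (μ : Measure (gasket q)) {e e' : E q m} (h : e ≠ e') :
    inner ℝ (edgeIndicator q m o μ e) (edgeIndicator q m o μ e') = 0 := by
  have := graphMeasure_range_edgePoint_ne_top q m o μ e
  have := graphMeasure_range_edgePoint_ne_top q m o μ e'
  rw [edgeIndicator, edgeIndicator, L2.inner_indicatorConstLp_indicatorConstLp,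
    range_edgePoint_inter_of_ne h, measureReal_empty, zero_smul]

/-- Bessel's inequality: the edge indicators are orthogonal with squared norm `(∫ ψ_e dμ)⁻¹`, so
scaling by `√(∫ ψ_e dμ)` makes them orthonormal. -/
theorem sum_integral_mul_inner_sq_le {q : Fin 3 → Plane} {m : ℕ} {o : Orientation q m}
    {μ : Measure (gasket q)} (hpos : ∀ e, 0 < ∫ x, psiEdge q m o e x ∂μ)
    (f : Lp ℝ 2 (graphMeasure q m o μ)) :
    ∑ e : E q m, (∫ x, psiEdge q m o e x ∂μ) * inner ℝ (edgeIndicator q m o μ e) f ^ 2 ≤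
      ‖f‖ ^ 2 := by
  classical
  have hon : Orthonormal ℝ fun e : E q m =>
      √(∫ x, psiEdge q m o e x ∂μ) • edgeIndicator q m o μ e := by
    rw [orthonormal_iff_ite]
    intro e e'
    rw [real_inner_smul_left, real_inner_smul_right]
    split_ifs with h
    · subst h
      rw [inner_edgeIndicator_edgeIndicator hpos, ← mul_assoc, Real.mul_self_sqrt (hpos e).le,
        mul_inv_cancel₀ (hpos e).ne']
    · rw [inner_edgeIndicator_of_ne o μ h, mul_zero, mul_zero]
  refine le_of_eq_of_le (Finset.sum_congr rfl fun e _ => ?_)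
    (hon.sum_inner_products_le f (s := Finset.univ))
  rw [real_inner_smul_left, norm_mul, mul_pow, Real.norm_eq_abs, Real.norm_eq_abs, sq_abs, sq_abs,
    Real.sq_sqrt (hpos e).le]

/-- The class of `ψ_e` in `L²(K, μ)`. -/
noncomputable def psiEdgeLp (q : Fin 3 → Plane) (m : ℕ) (o : Orientation q m)
    (μ : Measure (gasket q)) [IsFiniteMeasure μ] (e : E q m) : Lp ℝ 2 μ :=
  ContinuousMap.toLp 2 μ ℝ (psiEdge q m o e)

/-- The operator `J_{0,m}` on the spaces of classes of square integrable functions. -/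
noncomputable def identificationLp (q : Fin 3 → Plane) (m : ℕ) (o : Orientation q m)
    (μ : Measure (gasket q)) [IsFiniteMeasure μ] :
    Lp ℝ 2 (graphMeasure q m o μ) →L[ℝ] Lp ℝ 2 μ :=
  ∑ e : E q m, (innerSL ℝ (edgeIndicator q m o μ e)).smulRight (psiEdgeLp q m o μ e)

theorem identificationLp_apply (q : Fin 3 → Plane) (m : ℕ) (o : Orientation q m)
    (μ : Measure (gasket q)) [IsFiniteMeasure μ] (f : Lp ℝ 2 (graphMeasure q m o μ)) :
    identificationLp q m o μ f =
      ∑ e : E q m, inner ℝ (edgeIndicator q m o μ e) f • psiEdgeLp q m o μ e := by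
  simp [identificationLp]

theorem identificationLp_eq_toLp (q : Fin 3 → Plane) (m : ℕ) (o : Orientation q m)
    (μ : Measure (gasket q)) [IsFiniteMeasure μ] (f : Lp ℝ 2 (graphMeasure q m o μ)) :
    identificationLp q m o μ f = ContinuousMap.toLp 2 μ ℝ
      (∑ e : E q m, inner ℝ (edgeIndicator q m o μ e) f • psiEdge q m o e) := by
  simp only [identificationLp_apply, psiEdgeLp, map_sum, map_smul]

theorem identificationLp_toLp {q : Fin 3 → Plane} {m : ℕ} {o : Orientation q m}
    {μ : Measure (gasket q)} [IsFiniteMeasure μ] (hpos : ∀ e, 0 < ∫ x, psiEdge q m o e x ∂μ)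
    {f : X q m → ℝ} (hf : MemLp f 2 (graphMeasure q m o μ)) :
    (identificationLp q m o μ (hf.toLp f) : gasket q → ℝ) =ᵐ[μ] identification q m o f := by
  rw [identificationLp_eq_toLp]
  simp_rw [fun e => inner_edgeIndicator_toLp (hpos e) hf]
  exact ContinuousMap.coeFn_toLp μ _

theorem integrable_of_continuous_gasket {q : Fin 3 → Plane} (μ : Measure (gasket q))
    [IsFiniteMeasure μ] {f : gasket q → ℝ} (hf : Continuous f) : Integrable f μ :=
  hf.integrable_of_hasCompactSupport (HasCompactSupport.of_compactSpace f)

theorem norm_identificationLp_le {q : Fin 3 → Plane}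
    (hq : ∀ k l : Fin 3, k ≠ l → dist (q k) (q l) = 1) {m : ℕ} {o : Orientation q m}
    {μ : Measure (gasket q)} [IsFiniteMeasure μ] (hpos : ∀ e, 0 < ∫ x, psiEdge q m o e x ∂μ)
    (f : Lp ℝ 2 (graphMeasure q m o μ)) : ‖identificationLp q m o μ f‖ ≤ ‖f‖ := by
  refine le_of_sq_le_sq ?_ (norm_nonneg f)
  refine le_trans ?_ (sum_integral_mul_inner_sq_le hpos f)
  rw [← real_inner_self_eq_norm_sq, identificationLp_eq_toLp, ContinuousMap.inner_toLp]
  set a : E q m → ℝ := fun e => inner ℝ (edgeIndicator q m o μ e) f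
  have hpt : ∀ x, (∑ e, a e • psiEdge q m o e) x * (∑ e, a e • psiEdge q m o e) x ≤
      ∑ e, psiEdge q m o e x * a e ^ 2 := fun x => by
    rw [ContinuousMap.sum_apply, ← sq]
    -- Cauchy-Schwarz with the weights `ψ_e(x)`, through `(a_e ψ_e)² = ψ_e · (ψ_e a_e²)`; the factor
    -- `∑ ψ_e(x) ≤ 1` is then dropped.
    refine (Finset.sum_sq_le_sum_mul_sum_of_sq_le_mul Finset.univ
      (f := fun e => psiEdge q m o e x) (g := fun e => psiEdge q m o e x * a e ^ 2)
      (fun e _ => psiEdge_nonneg hq o e x)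
      (fun e _ => mul_nonneg (psiEdge_nonneg hq o e x) (sq_nonneg _)) fun e _ => ?_).trans ?_
    · refine le_of_eq ?_
      rw [ContinuousMap.smul_apply, smul_eq_mul]
      ring
    · exact mul_le_of_le_one_left (Finset.sum_nonneg fun e _ =>
        mul_nonneg (psiEdge_nonneg hq o e x) (sq_nonneg _)) (sum_psiEdge_le_one hq o x)
  refine (integral_mono (integrable_of_continuous_gasket μ (by fun_prop))
    (integrable_of_continuous_gasket μ (by fun_prop)) hpt).trans_eq ?_
  rw [integral_finsetSum _ fun e _ => integrable_of_continuous_gasket μ (by fun_prop)]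
  exact Finset.sum_congr rfl fun e _ => integral_mul_const _ _

theorem adjoint_identificationLp_apply (q : Fin 3 → Plane) (m : ℕ) (o : Orientation q m)
    (μ : Measure (gasket q)) [IsFiniteMeasure μ] (u : Lp ℝ 2 μ) :
    ContinuousLinearMap.adjoint (identificationLp q m o μ) u =
      ∑ e : E q m, inner ℝ u (psiEdgeLp q m o μ e) • edgeIndicator q m o μ e := by
  refine ext_inner_right ℝ fun f => ?_
  rw [ContinuousLinearMap.adjoint_inner_left, identificationLp_apply, inner_sum, sum_inner]
  refine Finset.sum_congr rfl fun e _ => ?_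
  rw [real_inner_smul_left, real_inner_smul_right, mul_comm]

theorem inner_psiEdgeLp (q : Fin 3 → Plane) (m : ℕ) (o : Orientation q m)
    (μ : Measure (gasket q)) [IsFiniteMeasure μ] (u : Lp ℝ 2 μ) (e : E q m) :
    inner ℝ u (psiEdgeLp q m o μ e) = ∫ x, u x * psiEdge q m o e x ∂μ := by
  rw [L2.inner_def]
  refine integral_congr_ae ?_
  filter_upwards [ContinuousMap.coeFn_toLp (p := 2) (𝕜 := ℝ) μ (psiEdge q m o e)] with x hx
  rw [psiEdgeLp, hx]
  simp [mul_comm]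

theorem coeFn_adjoint_identificationLp (q : Fin 3 → Plane) (m : ℕ) (o : Orientation q m)
    (μ : Measure (gasket q)) [IsFiniteMeasure μ] (u : Lp ℝ 2 μ) :
    (ContinuousLinearMap.adjoint (identificationLp q m o μ) u : X q m → ℝ)
      =ᵐ[graphMeasure q m o μ] fun t => ∑ e : E q m, (range (edgePoint q m e)).indicator
        (fun _ => (∫ x, u x * psiEdge q m o e x ∂μ) / ∫ x, psiEdge q m o e x ∂μ) t := by
  rw [adjoint_identificationLp_apply]
  have h : ∀ e : E q m, (inner ℝ u (psiEdgeLp q m o μ e) • edgeIndicator q m o μ e :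
      Lp ℝ 2 (graphMeasure q m o μ)) =ᵐ[graphMeasure q m o μ]
        (range (edgePoint q m e)).indicator
          (fun _ => (∫ x, u x * psiEdge q m o e x ∂μ) / ∫ x, psiEdge q m o e x ∂μ) := fun e => by
    filter_upwards [Lp.coeFn_smul (inner ℝ u (psiEdgeLp q m o μ e)) (edgeIndicator q m o μ e),
      indicatorConstLp_coeFn (p := 2) (hs := measurableSet_range_edgePoint q m e)
        (hμs := graphMeasure_range_edgePoint_ne_top q m o μ e)
        (c := (∫ x, psiEdge q m o e x ∂μ)⁻¹) (μ := graphMeasure q m o μ)] with t h1 h2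
    rw [h1, Pi.smul_apply, edgeIndicator, h2, inner_psiEdgeLp, indicator, indicator]
    split_ifs
    · rw [smul_eq_mul, div_eq_mul_inv]
    · rw [smul_zero]
  filter_upwards [Lp.coeFn_finsetSum Finset.univ fun e : E q m =>
    inner ℝ u (psiEdgeLp q m o μ e) • edgeIndicator q m o μ e, eventually_all.2 h] with t h1 h2
  rw [h1, Finset.sum_apply]
  exact Finset.sum_congr rfl fun e _ => h2 e

end SG

theorem propositionP
    (q : Fin 3 → SG.Plane) (hq : ∀ k l : Fin 3, k ≠ l → dist (q k) (q l) = 1)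
    (μ : Measure (SG.gasket q)) [IsFiniteMeasure μ] [NullSingletonClass μ] [μ.IsOpenPosMeasure]
    (m : ℕ) (o : SG.Orientation q m) :
    -- the objects are well defined, and the denominators below do not vanish
    (∀ p : SG.V q m, ∃! ψ : C(SG.gasket q, ℝ), SG.IsHarmonicSpline q m p ψ) ∧
    (∀ e : SG.E q m, 0 < ∫ x, SG.psiEdge q m o e x ∂μ) ∧
    -- the operator on the spaces of classes of square integrable functions
    ∃ J : Lp ℝ 2 (SG.graphMeasure q m o μ) →L[ℝ] Lp ℝ 2 μ,
      (∀ (f : SG.X q m → ℝ) (hf : MemLp f 2 (SG.graphMeasure q m o μ)),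
        (J (hf.toLp f) : SG.gasket q → ℝ) =ᵐ[μ] SG.identification q m o f) ∧
      (∀ f : Lp ℝ 2 (SG.graphMeasure q m o μ), ‖J f‖ ≤ ‖f‖) ∧
      ∀ u : Lp ℝ 2 μ,
        (ContinuousLinearMap.adjoint J u : SG.X q m → ℝ) =ᵐ[SG.graphMeasure q m o μ]
          fun t => ∑ e : SG.E q m, (range (SG.edgePoint q m e)).indicator
            (fun _ => (∫ x, u x * SG.psiEdge q m o e x ∂μ) / ∫ x, SG.psiEdge q m o e x ∂μ) t := by
  have hpos := SG.integral_psiEdge_pos hq μ o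
  exact ⟨SG.existsUnique_isHarmonicSpline hq, hpos, SG.identificationLp q m o μ,
    fun f hf => SG.identificationLp_toLp hpos hf, SG.norm_identificationLp_le hq hpos,
    SG.coeFn_adjoint_identificationLp q m o μ⟩
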